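/- Let $q$ be a complex number with $0<|q|<1$. Fix any fourth root $q^{1/4}$ of $q$, and write $q^{n/4}:=(q^{1/4})^n$ for $n\in\mathbb Z$. Put $$(a;q)_n:=\prod_{k=0}^{n-1}(1-aq^k),\qquad (a;q)_\infty:=\prod_{k=0}^{\infty}(1-aq^k),$$ $$J_m:=(q^m;q^m)_\infty,\qquad J_{a,m}:=(q^a;q^m)_\infty\,(q^{m-a};q^m)_\infty\,(q^m;q^m)_\infty .$$ For all complex $u,v,w,t$ the series $$F(u,v,w,t;q^2):=\sum_{i,j,k,l\ge 0}\frac{u^iv^jw^kt^l\,q^{i^2+j^2+k^2+5l^2/4-il-jl+kl}}{(q^2;q^2)_i(q^2;q^2)_j(q^2;q^2)_k(q^2;q^2)_l}$$ converges absolutely and satisfies $$F(u,v,w,t;q^2)=F(v,u,w,t;q^2).$$ Moreover, $$F(q^{-1},q,q^{-1},q^{-1/2};q^2)=4\frac{J_4^3J_{8,20}}{J_2^4}+q^{-1/4}\frac{J_2^7J_{3,10}J_{4,20}}{J_1^4J_4^4J_{20}},$$ $$F(1,1,1,q^{-1};q^2)=\frac{J_2^7J_{3,10}J_{4,20}}{J_1^4J_4^4J_{20}}+4q^{1/4}\frac{J_4^3J_{8,20}}{J_2^4},$$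 $$F(1,1,1,1;q^2)=\frac{J_2^7J_{1,10}J_{8,20}}{J_1^4J_4^4J_{20}}+4q^{5/4}\frac{J_4^3J_{4,20}}{J_2^4}.$$ -/

import Mathlib

/-- The finite `q`-shifted factorial `(a;q)_n = ∏_{k=0}^{n-1} (1 - a q^k)`. -/
noncomputable def qPoch (a q : ℂ) (n : ℕ) : ℂ :=
  ∏ k ∈ Finset.range n, (1 - a * q ^ k)

/-- The infinite `q`-shifted factorial `(a;q)_∞ = ∏_{k=0}^∞ (1 - a q^k)`. -/
noncomputable def qPochInf (a q : ℂ) : ℂ :=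
  ∏' k : ℕ, (1 - a * q ^ k)

/-- The infinite product defining `(a;q)_∞` converges whenever `|q| < 1`. -/
theorem multipliable_qPochInf (a : ℂ) {q : ℂ} (hq : ‖q‖ < 1) :
    Multipliable fun k : ℕ => (1 - a * q ^ k) := by
  have h : Summable fun k : ℕ => ‖-(a * q ^ k)‖ := by
    simp only [norm_neg, norm_mul, norm_pow]
    exact (summable_geometric_of_lt_one (norm_nonneg q) hq).mul_left ‖a‖
  simpa [sub_eq_add_neg] using multipliable_one_add_of_summable h

/-- `J_m = (q^m;q^m)_∞`. -/
noncomputable def qJ (q : ℂ) (m : ℕ) : ℂ :=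
  qPochInf (q ^ m) (q ^ m)

/-- `J_{a,m} = (q^a, q^{m-a}, q^m; q^m)_∞`. -/
noncomputable def qJ₂ (q : ℂ) (a : ℤ) (m : ℕ) : ℂ :=
  qPochInf (q ^ a) (q ^ m) * qPochInf (q ^ ((m : ℤ) - a)) (q ^ m) * qPochInf (q ^ m) (q ^ m)

/-- The general term of the quadruple series. The variable `r` is a chosen fourth root of `q`,
so `q = r ^ 4` and
`q^{i²+j²+k²+5l²/4-il-jl+kl} = r^{4i²+4j²+4k²+5l²-4il-4jl+4kl}`. -/
noncomputable def nahmTerm (r u v w t : ℂ) (n : ℕ × ℕ × ℕ × ℕ) : ℂ :=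
  match n with
  | (i, j, k, l) =>
    u ^ i * v ^ j * w ^ k * t ^ l *
        r ^ (4 * (i : ℤ) ^ 2 + 4 * (j : ℤ) ^ 2 + 4 * (k : ℤ) ^ 2 + 5 * (l : ℤ) ^ 2
          - 4 * (i : ℤ) * l - 4 * (j : ℤ) * l + 4 * (k : ℤ) * l) /
      (qPoch ((r ^ 4) ^ 2) ((r ^ 4) ^ 2) i * qPoch ((r ^ 4) ^ 2) ((r ^ 4) ^ 2) j *
        qPoch ((r ^ 4) ^ 2) ((r ^ 4) ^ 2) k * qPoch ((r ^ 4) ^ 2) ((r ^ 4) ^ 2) l)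

/-- The quadruple series `F(u,v,w,t;q²)`, where `q = r ^ 4`. -/
noncomputable def nahmF (r u v w t : ℂ) : ℂ :=
  ∑' n : ℕ × ℕ × ℕ × ℕ, nahmTerm r u v w t n

/-!
Summing over `i, j, k` by Euler's identity leaves a single series over `l`, whose summand is a
product of three infinite products. At the special points these are, up to finite products,
constant on each parity class of `l`, and the even and the odd part of the series become one of
Slater's identities (15), (19) in base `q` and one of (44), (46) in base `q²`. Each of these is
reduced to a Rogers–Ramanujan series by Bailey's device: expand the infinite product in the
summand `q^{m²} (…)_∞` by Euler's identity, use `m² + 2mk + k² = (m + k)²`, and recognise the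
inner sum as a coefficient of a product of formal `q`-exponentials that simplifies. The
Rogers–Ramanujan series is evaluated as by Selberg and Andrews: it satisfies the same second-order
`q`-difference equation as an alternating series that the Jacobi triple product sums.
-/

open Filter Topology

section QPochhammer

variable {a q : ℂ}

theorem qPoch_zero (a q : ℂ) : qPoch a q 0 = 1 := Finset.prod_range_zero _

theorem qPoch_one (a q : ℂ) : qPoch a q 1 = 1 - a := by simp [qPoch]

theorem qPoch_succ (a q : ℂ) (n : ℕ) : qPoch a q (n + 1) = qPoch a q n * (1 - a * q ^ n) :=
  Finset.prod_range_succ _ _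

theorem qPoch_add (a q : ℂ) (m n : ℕ) :
    qPoch a q (m + n) = qPoch a q m * qPoch (a * q ^ m) q n := by
  simp only [qPoch, Finset.prod_range_add, mul_assoc, pow_add]

theorem qPoch_succ' (a q : ℂ) (n : ℕ) : qPoch a q (n + 1) = (1 - a) * qPoch (a * q) q n := by
  rw [add_comm, qPoch_add, qPoch_one, pow_one]

theorem qPoch_mul (a q : ℂ) (d n : ℕ) :
    qPoch a q (d * n) = ∏ j ∈ Finset.range d, qPoch (a * q ^ j) (q ^ d) n := by
  induction n with
  | zero => simp [qPoch_zero]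
  | succ n ih =>
    simp only [qPoch_succ, Finset.prod_mul_distrib, ← ih]
    rw [mul_add_one, qPoch_add, qPoch]
    congr 1
    exact Finset.prod_congr rfl fun j _ => by rw [mul_assoc, mul_assoc, ← pow_mul, mul_comm (q ^ j)]

theorem qPoch_mul_qPoch_neg (a q : ℂ) (n : ℕ) :
    qPoch a q n * qPoch (-a) q n = qPoch (a ^ 2) (q ^ 2) n := by
  simp only [qPoch, ← Finset.prod_mul_distrib]
  exact Finset.prod_congr rfl fun k _ => by ring

theorem norm_pow_lt_one (hq : ‖q‖ < 1) {n : ℕ} (hn : n ≠ 0) : ‖q ^ n‖ < 1 := by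
  rw [norm_pow]
  exact pow_lt_one₀ (norm_nonneg q) hq hn

theorem norm_lt_one_of_norm_pow_lt_one {n : ℕ} (h : ‖q ^ n‖ < 1) : ‖q‖ < 1 := by
  contrapose! h
  rw [norm_pow]
  exact one_le_pow₀ h

theorem norm_qPoch_le (a : ℂ) (hq : ‖q‖ < 1) (n : ℕ) :
    ‖qPoch a q n‖ ≤ Real.exp (‖a‖ / (1 - ‖q‖)) := by
  have hgeom : ∑ k ∈ Finset.range n, ‖q‖ ^ k ≤ (1 - ‖q‖)⁻¹ :=
    (summable_geometric_of_lt_one (norm_nonneg q) hq).sum_le_tsum _ (fun _ _ => by positivity)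
      |>.trans_eq (tsum_geometric_of_lt_one (norm_nonneg q) hq)
  calc ‖qPoch a q n‖ = ∏ k ∈ Finset.range n, ‖1 - a * q ^ k‖ := norm_prod _ _
    _ ≤ ∏ k ∈ Finset.range n, Real.exp (‖a‖ * ‖q‖ ^ k) := by
      refine Finset.prod_le_prod (fun _ _ => norm_nonneg _) fun k _ => ?_
      calc ‖1 - a * q ^ k‖ ≤ ‖a‖ * ‖q‖ ^ k + 1 := by
            simpa [add_comm] using norm_sub_le 1 (a * q ^ k)
        _ ≤ _ := Real.add_one_le_exp _
    _ = Real.exp (‖a‖ * ∑ k ∈ Finset.range n, ‖q‖ ^ k) := by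
      rw [← Real.exp_sum, Finset.mul_sum]
    _ ≤ Real.exp (‖a‖ / (1 - ‖q‖)) := by
      rw [div_eq_mul_inv]
      gcongr

theorem tendsto_qPoch (a : ℂ) (hq : ‖q‖ < 1) :
    Tendsto (qPoch a q) atTop (𝓝 (qPochInf a q)) :=
  (multipliable_qPochInf a hq).hasProd.tendsto_prod_nat

theorem qPochInf_eq_qPoch_mul (a : ℂ) (hq : ‖q‖ < 1) (n : ℕ) :
    qPochInf a q = qPoch a q n * qPochInf (a * q ^ n) q := by
  have h := (tendsto_qPoch a hq).comp (tendsto_add_atTop_nat n)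
  refine tendsto_nhds_unique h (((tendsto_qPoch (a * q ^ n) hq).const_mul (qPoch a q n)).congr ?_)
  intro m
  rw [Function.comp_apply, add_comm, qPoch_add]

theorem qPochInf_eq_one_sub_mul (a : ℂ) (hq : ‖q‖ < 1) :
    qPochInf a q = (1 - a) * qPochInf (a * q) q := by
  simpa only [qPoch_one, pow_one] using qPochInf_eq_qPoch_mul a hq 1

theorem qPochInf_eq_prod (a : ℂ) (hq : ‖q‖ < 1) {d : ℕ} (hd : d ≠ 0) :
    qPochInf a q = ∏ j ∈ Finset.range d, qPochInf (a * q ^ j) (q ^ d) := by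
  refine tendsto_nhds_unique
    ((tendsto_qPoch a hq).comp (tendsto_id.const_mul_atTop' (Nat.pos_of_ne_zero hd)))
    ((tendsto_finsetProd _ fun j _ => tendsto_qPoch (a * q ^ j) (norm_pow_lt_one hq hd)).congr
      fun n => ?_)
  exact (qPoch_mul a q d n).symm

theorem qPochInf_mul_qPochInf_neg (a : ℂ) (hq : ‖q‖ < 1) :
    qPochInf a q * qPochInf (-a) q = qPochInf (a ^ 2) (q ^ 2) :=
  tendsto_nhds_unique
    (((tendsto_qPoch a hq).mul (tendsto_qPoch (-a) hq)).congr (qPoch_mul_qPoch_neg a q))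
    (tendsto_qPoch (a ^ 2) (norm_pow_lt_one hq two_ne_zero))

theorem one_sub_ne_zero_of_norm_lt_one (ha : ‖a‖ < 1) : 1 - a ≠ 0 :=
  sub_ne_zero_of_ne fun h => by simp [← h] at ha

theorem norm_mul_pow_lt_one (ha : ‖a‖ < 1) (hq : ‖q‖ < 1) (n : ℕ) : ‖a * q ^ n‖ < 1 := by
  rw [norm_mul, norm_pow]
  exact mul_lt_one_of_nonneg_of_lt_one_left (norm_nonneg _) ha (pow_le_one₀ (norm_nonneg _) hq.le)

theorem one_sub_pow_ne_zero (hq : ‖q‖ < 1) {n : ℕ} (hn : n ≠ 0) : 1 - q ^ n ≠ 0 :=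
  one_sub_ne_zero_of_norm_lt_one (norm_pow_lt_one hq hn)

theorem qPoch_ne_zero (ha : ‖a‖ < 1) (hq : ‖q‖ < 1) (n : ℕ) : qPoch a q n ≠ 0 :=
  Finset.prod_ne_zero_iff.2 fun k _ =>
    one_sub_ne_zero_of_norm_lt_one (norm_mul_pow_lt_one ha hq k)

theorem qPochInf_ne_zero (ha : ‖a‖ < 1) (hq : ‖q‖ < 1) : qPochInf a q ≠ 0 := by
  have hsum : Summable fun k : ℕ => ‖-(a * q ^ k)‖ := by
    simp only [norm_neg, norm_mul, norm_pow]
    exact (summable_geometric_of_lt_one (norm_nonneg q) hq).mul_left ‖a‖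
  have hne (k : ℕ) : 1 + -(a * q ^ k) ≠ 0 := by
    rw [← sub_eq_add_neg]
    exact one_sub_ne_zero_of_norm_lt_one (norm_mul_pow_lt_one ha hq k)
  simpa only [qPochInf, sub_eq_add_neg] using tprod_one_add_ne_zero_of_summable hne hsum

theorem exists_norm_inv_qPoch_le (ha : ‖a‖ < 1) (hq : ‖q‖ < 1) :
    ∃ C, ∀ n, ‖(qPoch a q n)⁻¹‖ ≤ C := by
  obtain ⟨C, hC⟩ :=
    ((tendsto_qPoch a hq).inv₀ (qPochInf_ne_zero ha hq)).norm.bddAbove_range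
  exact ⟨C, fun n => hC ⟨n, rfl⟩⟩

theorem choose_two_succ (n : ℕ) : (n + 1).choose 2 = n + n.choose 2 := by
  rw [Nat.choose_succ_succ' n 1, Nat.choose_one_right]

theorem qPoch_div_pow (ha : a ≠ 0) (hq : q ≠ 0) (m : ℕ) :
    qPoch (a / q ^ m) q m = (-a) ^ m / q ^ (m + 1).choose 2 * qPoch (q / a) q m := by
  induction m with
  | zero => simp [qPoch_zero]
  | succ m ih =>
    have hshift : a / q ^ (m + 1) * q = a / q ^ m := by
      rw [pow_succ, div_mul_eq_mul_div, mul_div_mul_right _ _ hq]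
    rw [qPoch_succ', hshift, ih, qPoch_succ, choose_two_succ (m + 1)]
    field_simp
    ring

theorem qPochInf_div_pow (ha : a ≠ 0) (hq0 : q ≠ 0) (hq : ‖q‖ < 1) (m : ℕ) :
    qPochInf (a / q ^ m) q =
      (-a) ^ m / q ^ (m + 1).choose 2 * qPoch (q / a) q m * qPochInf a q := by
  rw [qPochInf_eq_qPoch_mul _ hq m, qPoch_div_pow ha hq0, div_mul_cancel₀ _ (pow_ne_zero m hq0)]

end QPochhammer

section Euler

variable {q : ℂ}

theorem summable_pow_choose_two_mul_pow {ρ : ℝ} (h0 : 0 ≤ ρ) (h1 : ρ < 1) (M : ℝ) :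
    Summable fun n : ℕ => ρ ^ n.choose 2 * M ^ n := by
  refine summable_of_ratio_norm_eventually_le (r := 1 / 2) (by norm_num) ?_
  have hlim : Tendsto (fun n : ℕ => ‖ρ ^ n * M‖) atTop (𝓝 0) := by
    simpa using ((tendsto_pow_atTop_nhds_zero_of_lt_one h0 h1).mul_const M).norm
  filter_upwards [hlim.eventually (ge_mem_nhds (show (0 : ℝ) < 1 / 2 by norm_num))] with n hn
  have hratio : ρ ^ (n + 1).choose 2 * M ^ (n + 1) = ρ ^ n * M * (ρ ^ n.choose 2 * M ^ n) := by
    rw [choose_two_succ]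
    ring
  rw [hratio, norm_mul]
  gcongr

theorem norm_pow_choose_two_mul_le {z c : ℂ} {R M : ℝ} (hz : ‖z‖ ≤ R) (hc : ‖c‖ ≤ M) (n : ℕ) :
    ‖q ^ n.choose 2 * z ^ n * c‖ ≤ ‖q‖ ^ n.choose 2 * R ^ n * M := by
  rw [norm_mul, norm_mul, norm_pow, norm_pow]
  have hR : 0 ≤ R := (norm_nonneg z).trans hz
  gcongr

theorem summable_norm_pow_choose_two_mul (hq : ‖q‖ < 1) (z : ℂ) {c : ℕ → ℂ} {M : ℝ}
    (hc : ∀ n, ‖c n‖ ≤ M) : Summable fun n : ℕ => ‖q ^ n.choose 2 * z ^ n * c n‖ :=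
  .of_nonneg_of_le (fun _ => norm_nonneg _)
    (fun n => norm_pow_choose_two_mul_le le_rfl (hc n) n)
    ((summable_pow_choose_two_mul_pow (norm_nonneg q) hq ‖z‖).mul_right M)

theorem tendsto_tsum_pow_choose_two_mul (hq : ‖q‖ < 1) {ι : Type*} {l : Filter ι} {z : ι → ℂ}
    {c : ι → ℕ → ℂ} {c₀ : ℂ} {M : ℝ} (hz : Tendsto z l (𝓝 0))
    (hc : ∀ᶠ i in l, ∀ n, ‖c i n‖ ≤ M) (hc₀ : Tendsto (c · 0) l (𝓝 c₀)) :
    Tendsto (fun i => ∑' n : ℕ, q ^ n.choose 2 * z i ^ n * c i n) l (𝓝 c₀) := by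
  have hlim : ∑' n : ℕ, (if n = 0 then c₀ else 0) = c₀ := by simp
  rw [← hlim]
  refine tendsto_tsum_of_dominated_convergence
    (bound := fun n => ‖q‖ ^ n.choose 2 * 1 ^ n * M)
    ((summable_pow_choose_two_mul_pow (norm_nonneg q) hq 1).mul_right M) (fun n => ?_) ?_
  · rcases eq_or_ne n 0 with rfl | hn
    · simpa using hc₀
    · have hzn : Tendsto (fun i => q ^ n.choose 2 * z i ^ n) l (𝓝 0) := by
        simpa [hn] using (hz.pow n).const_mul (q ^ n.choose 2)
      rw [if_neg hn]
      exact hzn.zero_mul_isBoundedUnder_le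
        (isBoundedUnder_of_eventually_le (hc.mono fun _ hi => hi n))
  · filter_upwards [hc, hz.norm.eventually (ge_mem_nhds (by simp : ‖(0 : ℂ)‖ < 1))] with i hi hzi n
    exact norm_pow_choose_two_mul_le hzi (hi n) n

theorem summable_norm_euler (hq : ‖q‖ < 1) (z : ℂ) :
    Summable fun n : ℕ => ‖q ^ n.choose 2 * z ^ n / qPoch q q n‖ := by
  obtain ⟨C, hC⟩ := exists_norm_inv_qPoch_le hq hq
  exact summable_norm_pow_choose_two_mul hq z hC

theorem tsum_euler_eq_one_add_mul (hq : ‖q‖ < 1) (z : ℂ) :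
    ∑' n : ℕ, q ^ n.choose 2 * z ^ n / qPoch q q n =
      (1 + z) * ∑' n : ℕ, q ^ n.choose 2 * (z * q) ^ n / qPoch q q n := by
  have hz := (summable_norm_euler hq z).of_norm
  have hzq := (summable_norm_euler hq (z * q)).of_norm
  rw [one_add_mul, ← tsum_mul_left, ← sub_eq_iff_eq_add', ← hz.tsum_sub hzq,
    (hz.sub hzq).tsum_eq_zero_add]
  simp only [pow_zero, Nat.choose_zero_succ, sub_self, zero_add]
  refine tsum_congr fun n => ?_
  have hn := qPoch_ne_zero hq hq n
  have hn' := qPoch_ne_zero hq hq (n + 1)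
  rw [qPoch_succ] at hn' ⊢
  rw [choose_two_succ, ← sub_div, ← mul_div_assoc, div_eq_div_iff hn' hn]
  ring

theorem tsum_euler (hq : ‖q‖ < 1) (z : ℂ) :
    ∑' n : ℕ, q ^ n.choose 2 * z ^ n / qPoch q q n = qPochInf (-z) q := by
  set E : ℂ → ℂ := fun z => ∑' n : ℕ, q ^ n.choose 2 * z ^ n / qPoch q q n with hE
  have hiter (n : ℕ) : E z = qPoch (-z) q n * E (z * q ^ n) := by
    induction n with
    | zero => simp [qPoch_zero]
    | succ n ih =>
      rw [ih, qPoch_succ, hE]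
      dsimp only
      rw [tsum_euler_eq_one_add_mul hq (z * q ^ n)]
      ring_nf
  have hE1 : Tendsto (fun n : ℕ => E (z * q ^ n)) atTop (𝓝 1) := by
    obtain ⟨C, hC⟩ := exists_norm_inv_qPoch_le hq hq
    refine tendsto_tsum_pow_choose_two_mul hq ?_ (.of_forall fun _ => hC) (by simp [qPoch_zero])
    simpa using (tendsto_pow_atTop_nhds_zero_of_norm_lt_one hq).const_mul z
  have hlim := (tendsto_qPoch (-z) hq).mul hE1
  rw [mul_one] at hlim
  exact tendsto_nhds_unique (tendsto_const_nhds.congr hiter) hlim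

theorem tendsto_qPochInf_nhds_zero (hq : ‖q‖ < 1) :
    Tendsto (fun a => qPochInf a q) (𝓝 0) (𝓝 1) := by
  obtain ⟨C, hC⟩ := exists_norm_inv_qPoch_le hq hq
  have h := tendsto_tsum_pow_choose_two_mul (c₀ := 1) (z := fun a => -a) hq
    (by simpa using (tendsto_id (x := 𝓝 (0 : ℂ))).neg) (.of_forall fun _ => hC)
    (by simp [qPoch_zero])
  exact h.congr fun a => by simpa [div_eq_mul_inv] using tsum_euler hq (-a)

end Euler

section FormalExponentials

open PowerSeries

/-- The formal `q`-exponential `e_q(X) = ∑ Xⁿ / (q;q)_n = 1 / (X;q)_∞`. -/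
noncomputable def qExpSmall (q : ℂ) : PowerSeries ℂ := mk fun n => (qPoch q q n)⁻¹

/-- The formal `q`-exponential `E_q(X) = ∑ q^{n(n-1)/2} Xⁿ / (q;q)_n = (-X;q)_∞`. -/
noncomputable def qExpBig (q : ℂ) : PowerSeries ℂ :=
  mk fun n => q ^ n.choose 2 * (qPoch q q n)⁻¹

variable {q : ℂ}

theorem coeff_qExpSmall (q : ℂ) (n : ℕ) : coeff n (qExpSmall q) = (qPoch q q n)⁻¹ := coeff_mk _ _

theorem coeff_qExpBig (q : ℂ) (n : ℕ) :
    coeff n (qExpBig q) = q ^ n.choose 2 * (qPoch q q n)⁻¹ := coeff_mk _ _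

theorem constantCoeff_qExpSmall (q : ℂ) : constantCoeff (qExpSmall q) = 1 := by
  rw [← coeff_zero_eq_constantCoeff_apply, coeff_qExpSmall, qPoch_zero, inv_one]

theorem constantCoeff_qExpBig (q : ℂ) : constantCoeff (qExpBig q) = 1 := by
  rw [← coeff_zero_eq_constantCoeff_apply, coeff_qExpBig, qPoch_zero, inv_one, mul_one,
    Nat.choose_zero_succ, pow_zero]

theorem constantCoeff_rescale (a : ℂ) (f : PowerSeries ℂ) :
    constantCoeff (rescale a f) = constantCoeff f := by
  rw [← coeff_zero_eq_constantCoeff_apply, coeff_rescale, pow_zero, one_mul,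
    coeff_zero_eq_constantCoeff_apply]

theorem one_sub_pow_ne_zero_of_not_isOfFinOrder (hq : ¬IsOfFinOrder q) {n : ℕ} (hn : n ≠ 0) :
    1 - q ^ n ≠ 0 :=
  sub_ne_zero_of_ne fun h => hq (isOfFinOrder_iff_pow_eq_one.2 ⟨n, Nat.pos_of_ne_zero hn, h.symm⟩)

theorem not_isOfFinOrder_pow (hq : ¬IsOfFinOrder q) {n : ℕ} (hn : n ≠ 0) :
    ¬IsOfFinOrder (q ^ n) :=
  fun h => hq (h.of_pow hn)

theorem not_isOfFinOrder_of_norm_lt_one (hq : ‖q‖ < 1) : ¬IsOfFinOrder q := fun h => by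
  obtain ⟨n, hn, h1⟩ := isOfFinOrder_iff_pow_eq_one.1 h
  exact one_sub_pow_ne_zero hq hn.ne' (by rw [h1, sub_self])

theorem inv_qPoch_succ_mul (hq : ¬IsOfFinOrder q) (n : ℕ) :
    (qPoch q q (n + 1))⁻¹ * (1 - q ^ (n + 1)) = (qPoch q q n)⁻¹ := by
  rw [qPoch_succ, mul_inv, ← pow_succ', mul_assoc,
    inv_mul_cancel₀ (one_sub_pow_ne_zero_of_not_isOfFinOrder hq n.succ_ne_zero), mul_one]

theorem one_sub_X_mul_qExpSmall (hq : ¬IsOfFinOrder q) :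
    (1 - X) * qExpSmall q = rescale q (qExpSmall q) := by
  ext n
  rw [sub_mul, one_mul, map_sub, coeff_rescale]
  cases n with
  | zero => simp
  | succ n =>
    rw [coeff_succ_X_mul, coeff_qExpSmall, coeff_qExpSmall, ← inv_qPoch_succ_mul hq n]
    ring

theorem one_add_X_mul_rescale_qExpBig (hq : ¬IsOfFinOrder q) :
    (1 + X) * rescale q (qExpBig q) = qExpBig q := by
  ext n
  rw [add_mul, one_mul, map_add, coeff_rescale]
  cases n with
  | zero => simp
  | succ n =>
    rw [coeff_succ_X_mul, coeff_rescale, coeff_qExpBig, coeff_qExpBig, ← inv_qPoch_succ_mul hq n,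
      choose_two_succ]
    ring

theorem eq_one_of_rescale_eq (hq : ¬IsOfFinOrder q) {f : PowerSeries ℂ}
    (h0 : constantCoeff f = 1) (h : rescale q f = f) : f = 1 := by
  ext n
  rcases eq_or_ne n 0 with rfl | hn
  · simpa using h0
  · have hn' : (1 - q ^ n) * coeff n f = 0 := by
      rw [sub_mul, one_mul, ← coeff_rescale, h, sub_self]
    rw [coeff_one, if_neg hn]
    exact (mul_eq_zero.1 hn').resolve_left (one_sub_pow_ne_zero_of_not_isOfFinOrder hq hn)

theorem qExpBig_mul_rescale_neg_one_qExpSmall (hq : ¬IsOfFinOrder q) :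
    qExpBig q * rescale (-1) (qExpSmall q) = 1 := by
  refine eq_one_of_rescale_eq hq (by simp [constantCoeff_rescale, constantCoeff_qExpSmall,
    constantCoeff_qExpBig]) ?_
  have hsmall := congrArg (rescale (-1)) (one_sub_X_mul_qExpSmall hq)
  rw [map_mul, map_sub, map_one, rescale_neg_one_X, rescale_rescale, mul_comm q,
    ← rescale_rescale] at hsmall
  rw [map_mul, ← hsmall]
  linear_combination
    rescale (-1) (qExpSmall q) * one_add_X_mul_rescale_qExpBig hq

theorem rescale_qExpBig_mul_rescale_neg_qExpSmall (hq : ¬IsOfFinOrder q) (a : ℂ) :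
    rescale a (qExpBig q) * rescale (-a) (qExpSmall q) = 1 := by
  have h := congrArg (rescale a) (qExpBig_mul_rescale_neg_one_qExpSmall hq)
  rwa [map_mul, rescale_rescale, map_one, neg_one_mul] at h

theorem qExpSmall_eq_mul (hq : ¬IsOfFinOrder q) :
    qExpSmall q = qExpSmall (q ^ 2) * rescale q (qExpSmall (q ^ 2)) := by
  have hq2 := not_isOfFinOrder_pow hq two_ne_zero
  have hinv := rescale_qExpBig_mul_rescale_neg_qExpSmall hq (-1)
  rw [neg_neg, rescale_one, RingHom.id_apply] at hinv
  suffices h : qExpSmall (q ^ 2) * rescale q (qExpSmall (q ^ 2)) * rescale (-1) (qExpBig q) = 1 by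
    linear_combination qExpSmall (q ^ 2) * rescale q (qExpSmall (q ^ 2)) * hinv - qExpSmall q * h
  refine eq_one_of_rescale_eq hq (by simp [constantCoeff_rescale, constantCoeff_qExpSmall,
    constantCoeff_qExpBig]) ?_
  have hbig := congrArg (rescale (-1)) (one_add_X_mul_rescale_qExpBig hq)
  rw [map_mul, map_add, map_one, rescale_neg_one_X, rescale_rescale, mul_comm q,
    ← rescale_rescale] at hbig
  rw [map_mul, map_mul, rescale_rescale, ← sq, ← one_sub_X_mul_qExpSmall hq2]
  linear_combination qExpSmall (q ^ 2) * rescale q (qExpSmall (q ^ 2)) * hbig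

theorem rescale_neg_one_qExpSmall_eq_mul (hq : ¬IsOfFinOrder q) :
    rescale (-1) (qExpSmall q) =
      rescale (-1) (qExpSmall (q ^ 2)) * rescale (-q) (qExpSmall (q ^ 2)) := by
  conv_lhs => rw [qExpSmall_eq_mul hq]
  rw [map_mul, rescale_rescale, mul_neg_one]

theorem qExpBig_eq_mul (hq : ¬IsOfFinOrder q) :
    qExpBig q = qExpBig (q ^ 2) * rescale q (qExpBig (q ^ 2)) := by
  have hq2 := not_isOfFinOrder_pow hq two_ne_zero
  have h := qExpBig_mul_rescale_neg_one_qExpSmall hq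
  have h₁ := qExpBig_mul_rescale_neg_one_qExpSmall hq2
  have h₂ := rescale_qExpBig_mul_rescale_neg_qExpSmall hq2 q
  rw [rescale_neg_one_qExpSmall_eq_mul hq] at h
  linear_combination qExpBig (q ^ 2) * rescale q (qExpBig (q ^ 2)) * h
    - qExpBig q * rescale q (qExpBig (q ^ 2)) * rescale (-q) (qExpSmall (q ^ 2)) * h₁
    - qExpBig q * h₂

theorem rescale_qExpBig_sq_mul_rescale_neg_one_qExpSmall (hq : ¬IsOfFinOrder q) :
    rescale q (qExpBig (q ^ 2)) * rescale (-1) (qExpSmall q) =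
      rescale (-1) (qExpSmall (q ^ 2)) := by
  rw [rescale_neg_one_qExpSmall_eq_mul hq]
  linear_combination rescale (-1) (qExpSmall (q ^ 2)) *
    rescale_qExpBig_mul_rescale_neg_qExpSmall (not_isOfFinOrder_pow hq two_ne_zero) q

theorem qExpBig_sq_mul_rescale_neg_one_qExpSmall (hq : ¬IsOfFinOrder q) :
    qExpBig (q ^ 2) * rescale (-1) (qExpSmall q) = rescale (-q) (qExpSmall (q ^ 2)) := by
  rw [rescale_neg_one_qExpSmall_eq_mul hq]
  linear_combination rescale (-q) (qExpSmall (q ^ 2)) *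
    qExpBig_mul_rescale_neg_one_qExpSmall (not_isOfFinOrder_pow hq two_ne_zero)

theorem qExpBig_mul_rescale_neg_one_qExpSmall_sq (hq : ¬IsOfFinOrder q) :
    qExpBig q * rescale (-1) (qExpSmall (q ^ 2)) = rescale q (qExpBig (q ^ 2)) := by
  rw [qExpBig_eq_mul hq]
  linear_combination rescale q (qExpBig (q ^ 2)) *
    qExpBig_mul_rescale_neg_one_qExpSmall (not_isOfFinOrder_pow hq two_ne_zero)

theorem qExpBig_mul_rescale_neg_qExpSmall_sq (hq : ¬IsOfFinOrder q) :
    qExpBig q * rescale (-q) (qExpSmall (q ^ 2)) = qExpBig (q ^ 2) := by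
  rw [qExpBig_eq_mul hq]
  linear_combination qExpBig (q ^ 2) *
    rescale_qExpBig_mul_rescale_neg_qExpSmall (not_isOfFinOrder_pow hq two_ne_zero) q

end FormalExponentials

section Bailey

open Finset PowerSeries

theorem tsum_prod_eq_tsum_sum_antidiagonal {f : ℕ × ℕ → ℂ} (hf : Summable f) :
    ∑' p, f p = ∑' n, ∑ p ∈ antidiagonal n, f p := by
  have hf' := (HasAntidiagonal.sigmaAntidiagonalEquivProd.summable_iff (f := f)).2 hf
  rw [← HasAntidiagonal.sigmaAntidiagonalEquivProd.tsum_eq f]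
  refine hf'.tsum_sigma.trans (tsum_congr fun n => ?_)
  rw [tsum_fintype, ← Finset.sum_coe_sort (antidiagonal n)]
  rfl

theorem two_mul_choose_two_add_self (n : ℕ) : 2 * n.choose 2 + n = n ^ 2 := by
  induction n with
  | zero => rfl
  | succ n ih => rw [choose_two_succ]; linarith

variable {x y s a : ℂ}

theorem summable_pow_sq_mul_pow {ρ : ℝ} (h0 : 0 ≤ ρ) (h1 : ρ < 1) (M : ℝ) :
    Summable fun n : ℕ => ρ ^ n ^ 2 * M ^ n := by
  have h := summable_pow_choose_two_mul_pow (sq_nonneg ρ) (pow_lt_one₀ h0 h1 two_ne_zero) (ρ * M)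
  refine h.congr fun n => ?_
  rw [← two_mul_choose_two_add_self, ← pow_mul, mul_pow]
  ring

theorem summable_sq_add_mul (hx : ‖x‖ < 1) (y : ℂ) {b c : ℕ → ℂ} {M D S : ℝ}
    (hb : ∀ m, ‖b m‖ ≤ M) (hc : ∀ k, ‖c k‖ ≤ S ^ k * D) :
    Summable fun p : ℕ × ℕ => x ^ (p.1 + p.2) ^ 2 * y ^ (p.1 + p.2) * (b p.1 * c p.2) := by
  have hu (R : ℝ) := (summable_pow_sq_mul_pow (norm_nonneg x) hx R).norm
  refine .of_norm_bounded
    ((summable_mul_of_summable_norm (hu ‖y‖) (hu (‖y‖ * S))).mul_right (M * D)) ?_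
  rintro ⟨m, k⟩
  have hM : 0 ≤ M := (norm_nonneg _).trans (hb 0)
  have hpow : ‖x‖ ^ (m + k) ^ 2 ≤ ‖x‖ ^ (m ^ 2 + k ^ 2) :=
    pow_le_pow_of_le_one (norm_nonneg x) hx.le (by rw [add_sq]; omega)
  have hbm := hb m
  have hck := hc k
  simp only [norm_mul, norm_pow]
  calc ‖x‖ ^ (m + k) ^ 2 * ‖y‖ ^ (m + k) * (‖b m‖ * ‖c k‖)
      ≤ ‖x‖ ^ (m ^ 2 + k ^ 2) * ‖y‖ ^ (m + k) * (M * (S ^ k * D)) := by gcongr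
    _ = _ := by ring

theorem tsum_euler_sq (hx : ‖x‖ < 1) (z : ℂ) :
    ∑' n : ℕ, x ^ n ^ 2 * z ^ n / qPoch (x ^ 2) (x ^ 2) n = qPochInf (-(x * z)) (x ^ 2) := by
  rw [← tsum_euler (norm_pow_lt_one hx two_ne_zero)]
  refine tsum_congr fun n => ?_
  rw [← two_mul_choose_two_add_self n, pow_add, pow_mul, mul_pow, mul_assoc]

/-- Expand the infinite product by Euler's identity and collect the terms `m + k = N`, using
`m² + 2mk + k² = N²`. -/
theorem tsum_sq_mul_qPochInf (hx : ‖x‖ < 1) (y s : ℂ) {A : PowerSeries ℂ} {M : ℝ}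
    (hA : ∀ m, ‖coeff m A‖ ≤ M) :
    ∑' m : ℕ, x ^ m ^ 2 * y ^ m * coeff m A * qPochInf (-(x ^ (2 * m + 1) * y * s)) (x ^ 2) =
      ∑' N : ℕ, x ^ N ^ 2 * y ^ N * coeff N (A * rescale s (qExpSmall (x ^ 2))) := by
  set f : ℕ × ℕ → ℂ := fun p => x ^ (p.1 + p.2) ^ 2 * y ^ (p.1 + p.2) *
    (coeff p.1 A * coeff p.2 (rescale s (qExpSmall (x ^ 2)))) with hf
  have hsum : Summable f := by
    have hx2 := norm_pow_lt_one hx two_ne_zero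
    obtain ⟨D, hD⟩ := exists_norm_inv_qPoch_le hx2 hx2
    refine summable_sq_add_mul hx y (b := (coeff · A))
      (c := (coeff · (rescale s (qExpSmall (x ^ 2))))) (S := ‖s‖) (D := D) hA fun k => ?_
    rw [coeff_rescale, coeff_qExpSmall, norm_mul, norm_pow]
    exact mul_le_mul_of_nonneg_left (hD k) (by positivity)
  calc _ = ∑' p, f p := by
        rw [hsum.tsum_prod]
        refine tsum_congr fun m => ?_
        rw [show x ^ (2 * m + 1) * y * s = x * (x ^ (2 * m) * y * s) by ring, ← tsum_euler_sq hx,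
          ← tsum_mul_left]
        refine tsum_congr fun k => ?_
        simp only [hf, coeff_rescale, coeff_qExpSmall]
        ring
    _ = _ := by
        rw [tsum_prod_eq_tsum_sum_antidiagonal hsum]
        refine tsum_congr fun N => ?_
        rw [coeff_mul, mul_sum]
        refine sum_congr rfl fun p hp => ?_
        simp only [hf, mem_antidiagonal.1 hp]

theorem tsum_sq_div_qPoch_mul_qPochInf (hx : ‖x‖ < 1) {b : ℂ} (hb : ‖b‖ < 1) (d : ℕ)
    (hys : x * y * s = -(b * (x ^ 2) ^ d)) {A : PowerSeries ℂ} {M : ℝ}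
    (hA : ∀ m, ‖coeff m A‖ ≤ M) :
    (∑' m : ℕ, x ^ m ^ 2 * y ^ m * coeff m A / qPoch b (x ^ 2) (m + d)) * qPochInf b (x ^ 2) =
      ∑' N : ℕ, x ^ N ^ 2 * y ^ N * coeff N (A * rescale s (qExpSmall (x ^ 2))) := by
  have hx2 := norm_pow_lt_one hx two_ne_zero
  rw [← tsum_sq_mul_qPochInf hx y s hA, ← tsum_mul_right]
  refine tsum_congr fun m => ?_
  rw [qPochInf_eq_qPoch_mul _ hx2 (m + d), ← mul_assoc,
    div_mul_cancel₀ _ (qPoch_ne_zero hb hx2 _)]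
  congr 2
  linear_combination x ^ (2 * m) * hys

theorem norm_coeff_rescale_le (ha : ‖a‖ ≤ 1) (f : PowerSeries ℂ) (n : ℕ) :
    ‖coeff n (rescale a f)‖ ≤ ‖coeff n f‖ := by
  rw [coeff_rescale, norm_mul, norm_pow]
  exact mul_le_of_le_one_left (norm_nonneg _) (pow_le_one₀ (norm_nonneg a) ha)

theorem exists_norm_coeff_qExpSmall_le {q : ℂ} (hq : ‖q‖ < 1) :
    ∃ M, ∀ n, ‖coeff n (qExpSmall q)‖ ≤ M := by
  obtain ⟨M, hM⟩ := exists_norm_inv_qPoch_le hq hq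
  exact ⟨M, fun n => by simpa only [coeff_qExpSmall] using hM n⟩

theorem exists_norm_coeff_qExpBig_le {q : ℂ} (hq : ‖q‖ < 1) :
    ∃ M, ∀ n, ‖coeff n (qExpBig q)‖ ≤ M := by
  obtain ⟨M, hM⟩ := exists_norm_inv_qPoch_le hq hq
  refine ⟨M, fun n => le_trans ?_ (hM n)⟩
  rw [coeff_qExpBig, norm_mul, norm_pow]
  exact mul_le_of_le_one_left (norm_nonneg _) (pow_le_one₀ (norm_nonneg q) hq.le)

end Bailey

section Slater

open PowerSeries

/-- The Rogers–Ramanujan series `∑ q^{n²} aⁿ / (q;q)_n`; the classical cases are `a = 1` and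
`a = q`. -/
noncomputable def rogersRamanujan (q a : ℂ) : ℂ := ∑' n : ℕ, q ^ n ^ 2 * a ^ n / qPoch q q n

variable {q : ℂ}

theorem tsum_sq_mul_coeff_qExpSmall (q a : ℂ) :
    ∑' n : ℕ, q ^ n ^ 2 * a ^ n * coeff n (qExpSmall q) = rogersRamanujan q a := by
  simp only [coeff_qExpSmall, rogersRamanujan, div_eq_mul_inv]

theorem tsum_sq_div_qPoch_pow_four (hq : ‖q‖ < 1) :
    (∑' n : ℕ, q ^ n ^ 2 / qPoch (q ^ 4) (q ^ 4) n) * qPochInf (-q ^ 2) (q ^ 2) =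
      rogersRamanujan q 1 := by
  have hq2 := norm_pow_lt_one hq two_ne_zero
  obtain ⟨M, hM⟩ := exists_norm_coeff_qExpSmall_le hq2
  have h := tsum_sq_div_qPoch_mul_qPochInf (y := 1) (s := q) (b := -q ^ 2) hq
    (by rwa [norm_neg]) 0 (by ring) hM
  rw [← qExpSmall_eq_mul (not_isOfFinOrder_of_norm_lt_one hq), tsum_sq_mul_coeff_qExpSmall] at h
  rw [← h]
  congr! 3 with n
  rw [coeff_qExpSmall, show q ^ 4 = (q ^ 2) ^ 2 by ring, ← qPoch_mul_qPoch_neg, add_zero]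
  ring

theorem tsum_sq_mul_pow_div_qPoch_pow_four (hq : ‖q‖ < 1) :
    (∑' n : ℕ, q ^ n ^ 2 * (q ^ 2) ^ n / qPoch (q ^ 4) (q ^ 4) n) * qPochInf (-q ^ 2) (q ^ 2) =
      rogersRamanujan q q := by
  have hq2 := norm_pow_lt_one hq two_ne_zero
  obtain ⟨M, hM⟩ := exists_norm_coeff_qExpSmall_le hq2
  have h := tsum_sq_div_qPoch_mul_qPochInf (y := q) (s := 1) (b := -q ^ 2) hq
    (by rwa [norm_neg]) 0 (by ring) (fun n => (norm_coeff_rescale_le hq.le _ n).trans (hM n))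
  rw [rescale_one, RingHom.id_apply, mul_comm (rescale q _),
    ← qExpSmall_eq_mul (not_isOfFinOrder_of_norm_lt_one hq), tsum_sq_mul_coeff_qExpSmall] at h
  rw [← h]
  congr! 3 with n
  rw [coeff_rescale, coeff_qExpSmall, show q ^ 4 = (q ^ 2) ^ 2 by ring, ← qPoch_mul_qPoch_neg,
    add_zero]
  ring

theorem neg_pow_sq (q : ℂ) (n : ℕ) : (-q) ^ n ^ 2 = (-1) ^ n * q ^ n ^ 2 := by
  rw [neg_pow, sq, pow_mul]
  rcases neg_one_pow_eq_or ℂ n with h | h <;> simp [h]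

theorem rogersRamanujan_neg_one_eq (hq : ‖q‖ < 1) :
    rogersRamanujan (-q) 1 =
      (∑' n : ℕ, (-1) ^ n * q ^ n ^ 2 / qPoch (q ^ 4) (q ^ 4) n) * qPochInf (-q ^ 2) (q ^ 2) := by
  rw [← tsum_sq_div_qPoch_pow_four (q := -q) (by rwa [norm_neg])]
  simp only [neg_pow_sq, neg_sq, Even.neg_pow (by decide : Even 4)]

theorem rogersRamanujan_neg_self_eq (hq : ‖q‖ < 1) :
    rogersRamanujan (-q) (-q) =
      (∑' n : ℕ, (-1) ^ n * q ^ n ^ 2 * (q ^ 2) ^ n / qPoch (q ^ 4) (q ^ 4) n) *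
        qPochInf (-q ^ 2) (q ^ 2) := by
  rw [← tsum_sq_mul_pow_div_qPoch_pow_four (q := -q) (by rwa [norm_neg])]
  simp only [neg_pow_sq, neg_sq, Even.neg_pow (by decide : Even 4)]

theorem tsum_slater_19 (hq : ‖q‖ < 1) :
    (∑' m : ℕ, q ^ (3 * m ^ 2) / (qPoch q (q ^ 2) m * qPoch (q ^ 4) (q ^ 4) m)) *
      qPochInf q (q ^ 2) * qPochInf (-q ^ 2) (q ^ 2) = rogersRamanujan (-q) 1 := by
  have hq2 := norm_pow_lt_one hq two_ne_zero
  obtain ⟨M, hM⟩ := exists_norm_coeff_qExpBig_le (norm_pow_lt_one hq2 two_ne_zero)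
  have h := tsum_sq_div_qPoch_mul_qPochInf (y := 1) (s := -1) hq hq 0 (by ring)
    (fun n => (norm_coeff_rescale_le hq2.le _ n).trans (hM n))
  rw [rescale_qExpBig_sq_mul_rescale_neg_one_qExpSmall (not_isOfFinOrder_of_norm_lt_one hq2),
    show (q ^ 2) ^ 2 = q ^ 4 by ring] at h
  rw [rogersRamanujan_neg_one_eq hq]
  congr 1
  refine (congrArg (· * qPochInf q (q ^ 2)) (tsum_congr fun m => ?_)).trans
    (h.trans (tsum_congr fun N => ?_))
  · rw [coeff_rescale, coeff_qExpBig, ← two_mul_choose_two_add_self, add_zero]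
    ring
  · rw [coeff_rescale, coeff_qExpSmall]
    ring

theorem tsum_slater_15 (hq : ‖q‖ < 1) :
    (∑' m : ℕ, q ^ (m ^ 2 + 4 * m.choose 2) / (qPoch q (q ^ 2) m * qPoch (q ^ 4) (q ^ 4) m)) *
      qPochInf q (q ^ 2) * qPochInf (-q ^ 2) (q ^ 2) = rogersRamanujan (-q) (-q) := by
  have hq2 := norm_pow_lt_one hq two_ne_zero
  obtain ⟨M, hM⟩ := exists_norm_coeff_qExpBig_le (norm_pow_lt_one hq2 two_ne_zero)
  have h := tsum_sq_div_qPoch_mul_qPochInf (y := 1) (s := -1) hq hq 0 (by ring) hM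
  rw [qExpBig_sq_mul_rescale_neg_one_qExpSmall (not_isOfFinOrder_of_norm_lt_one hq2),
    show (q ^ 2) ^ 2 = q ^ 4 by ring] at h
  rw [rogersRamanujan_neg_self_eq hq]
  congr 1
  refine (congrArg (· * qPochInf q (q ^ 2)) (tsum_congr fun m => ?_)).trans
    (h.trans (tsum_congr fun N => ?_))
  · rw [coeff_qExpBig, add_zero]
    ring
  · rw [coeff_rescale, coeff_qExpSmall, neg_pow (q ^ 2)]
    ring

theorem tsum_slater_15_shift (hq : ‖q‖ < 1) :
    (∑' m : ℕ, q ^ (3 * m ^ 2 + 2 * m) /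
        (qPoch q (q ^ 2) (m + 1) * qPoch (q ^ 4) (q ^ 4) m)) *
      qPochInf q (q ^ 2) * qPochInf (-q ^ 2) (q ^ 2) = rogersRamanujan (-q) (-q) := by
  have hq2 := norm_pow_lt_one hq two_ne_zero
  obtain ⟨M, hM⟩ := exists_norm_coeff_qExpBig_le (norm_pow_lt_one hq2 two_ne_zero)
  have h := tsum_sq_div_qPoch_mul_qPochInf (y := q ^ 2) (s := -1) hq hq 1 (by ring)
    (fun n => (norm_coeff_rescale_le hq2.le _ n).trans (hM n))
  rw [rescale_qExpBig_sq_mul_rescale_neg_one_qExpSmall (not_isOfFinOrder_of_norm_lt_one hq2),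
    show (q ^ 2) ^ 2 = q ^ 4 by ring] at h
  rw [rogersRamanujan_neg_self_eq hq]
  congr 1
  refine (congrArg (· * qPochInf q (q ^ 2)) (tsum_congr fun m => ?_)).trans
    (h.trans (tsum_congr fun N => ?_))
  · rw [coeff_rescale, coeff_qExpBig, ← two_mul_choose_two_add_self]
    ring
  · rw [coeff_rescale, coeff_qExpSmall]
    ring

theorem tsum_slater_46 (hq : ‖q‖ < 1) :
    (∑' m : ℕ, q ^ (m ^ 2 + m.choose 2) / (qPoch q (q ^ 2) m * qPoch q q m)) *
      qPochInf q (q ^ 2) = rogersRamanujan (q ^ 2) 1 := by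
  obtain ⟨M, hM⟩ := exists_norm_coeff_qExpBig_le hq
  have h := tsum_sq_div_qPoch_mul_qPochInf (y := 1) (s := -1) hq hq 0 (by ring) hM
  rw [qExpBig_mul_rescale_neg_one_qExpSmall_sq (not_isOfFinOrder_of_norm_lt_one hq)] at h
  refine (congrArg (· * qPochInf q (q ^ 2)) (tsum_congr fun m => ?_)).trans
    (h.trans (tsum_congr fun N => ?_))
  · rw [coeff_qExpBig, add_zero]
    ring
  · rw [coeff_rescale, coeff_qExpBig, ← two_mul_choose_two_add_self]
    ring

theorem tsum_slater_46_shift (hq : ‖q‖ < 1) :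
    (∑' m : ℕ, q ^ (m ^ 2 + m.choose 2 + m) / (qPoch q (q ^ 2) (m + 1) * qPoch q q m)) *
      qPochInf q (q ^ 2) = rogersRamanujan (q ^ 2) 1 := by
  obtain ⟨M, hM⟩ := exists_norm_coeff_qExpBig_le hq
  have h := tsum_sq_div_qPoch_mul_qPochInf (y := q) (s := -q) hq hq 1 (by ring) hM
  rw [qExpBig_mul_rescale_neg_qExpSmall_sq (not_isOfFinOrder_of_norm_lt_one hq)] at h
  refine (congrArg (· * qPochInf q (q ^ 2)) (tsum_congr fun m => ?_)).trans
    (h.trans (tsum_congr fun N => ?_))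
  · rw [coeff_qExpBig]
    ring
  · rw [coeff_qExpBig, ← two_mul_choose_two_add_self]
    ring

theorem tsum_slater_44 (hq : ‖q‖ < 1) :
    (∑' m : ℕ, q ^ (m ^ 2 + m.choose 2 + 2 * m) / (qPoch q (q ^ 2) (m + 1) * qPoch q q m)) *
      qPochInf q (q ^ 2) = rogersRamanujan (q ^ 2) (q ^ 2) := by
  obtain ⟨M, hM⟩ := exists_norm_coeff_qExpBig_le hq
  have h := tsum_sq_div_qPoch_mul_qPochInf (y := q ^ 2) (s := -1) hq hq 1 (by ring) hM
  rw [qExpBig_mul_rescale_neg_one_qExpSmall_sq (not_isOfFinOrder_of_norm_lt_one hq)] at h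
  refine (congrArg (· * qPochInf q (q ^ 2)) (tsum_congr fun m => ?_)).trans
    (h.trans (tsum_congr fun N => ?_))
  · rw [coeff_qExpBig]
    ring
  · rw [coeff_rescale, coeff_qExpBig, ← two_mul_choose_two_add_self]
    ring

end Slater

section RogersRamanujan

/-- The products `∏_{i<k} (1 + ‖c i‖) · max ‖D k‖ ‖D (k + 1)‖` increase with `k` and tend to `0`. -/
theorem eq_zero_of_recurrence {𝕜 E : Type*} [NormedField 𝕜] [NormedAddCommGroup E]
    [NormedSpace 𝕜 E] {c : ℕ → 𝕜} {D : ℕ → E} (hc : Summable fun k => ‖c k‖)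
    (h : ∀ k, D k = D (k + 1) + c k • D (k + 2)) (hD : Tendsto D atTop (𝓝 0)) (k : ℕ) :
    D k = 0 := by
  set u : ℕ → ℝ := fun k => max ‖D k‖ ‖D (k + 1)‖
  set P : ℕ → ℝ := fun k => ∏ i ∈ Finset.range k, (1 + ‖c i‖) with hP
  have hPpos (k : ℕ) : 0 < P k := Finset.prod_pos fun i _ => by positivity
  have hstep (k : ℕ) : u k ≤ (1 + ‖c k‖) * u (k + 1) := by
    have h₁ : ‖D (k + 1)‖ ≤ u (k + 1) := le_max_left _ _
    have h₂ : ‖D (k + 2)‖ ≤ u (k + 1) := le_max_right _ _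
    have h₃ : ‖c k • D (k + 2)‖ ≤ ‖c k‖ * u (k + 1) := by
      rw [norm_smul]
      gcongr
    rw [one_add_mul]
    refine max_le ?_ (by linarith [norm_nonneg (c k • D (k + 2))])
    rw [h k]
    exact (norm_add_le _ _).trans (add_le_add h₁ h₃)
  have hmono : Monotone fun k => P k * u k := monotone_nat_of_le_succ fun k => by
    simp only [hP, Finset.prod_range_succ, mul_assoc]
    exact mul_le_mul_of_nonneg_left (hstep k) (hPpos k).le
  have hlim : Tendsto (fun k => P k * u k) atTop (𝓝 0) := by
    have hu0 : Tendsto u atTop (𝓝 0) := by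
      simpa using hD.norm.max ((tendsto_add_atTop_iff_nat 1).2 hD).norm
    simpa using (Real.multipliable_one_add_of_summable hc).hasProd.tendsto_prod_nat.mul hu0
  have huk : u k ≤ 0 := nonpos_of_mul_nonpos_right (hmono.ge_of_tendsto hlim k) (hPpos k)
  exact norm_le_zero_iff.1 ((le_max_left _ _).trans huk)

variable {q : ℂ}

theorem sq_mul_pow_eq_choose_two (q a : ℂ) (n : ℕ) :
    q ^ n ^ 2 * a ^ n = (q ^ 2) ^ n.choose 2 * (a * q) ^ n := by
  rw [← two_mul_choose_two_add_self]
  ring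

theorem summable_rogersRamanujan (hq : ‖q‖ < 1) (a : ℂ) :
    Summable fun n : ℕ => q ^ n ^ 2 * a ^ n / qPoch q q n := by
  obtain ⟨C, hC⟩ := exists_norm_inv_qPoch_le hq hq
  simp only [sq_mul_pow_eq_choose_two, div_eq_mul_inv]
  exact (summable_norm_pow_choose_two_mul (norm_pow_lt_one hq two_ne_zero) _ hC).of_norm

theorem rogersRamanujan_eq_add (hq : ‖q‖ < 1) (a : ℂ) :
    rogersRamanujan q a =
      rogersRamanujan q (a * q) + a * q * rogersRamanujan q (a * q ^ 2) := by
  have h₀ := summable_rogersRamanujan hq a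
  have h₁ := summable_rogersRamanujan hq (a * q)
  rw [← sub_eq_iff_eq_add', rogersRamanujan, rogersRamanujan, rogersRamanujan, ← h₀.tsum_sub h₁,
    ← tsum_mul_left, (h₀.sub h₁).tsum_eq_zero_add, pow_zero, pow_zero, sub_self, zero_add]
  refine tsum_congr fun n => ?_
  have hn := qPoch_ne_zero hq hq n
  have hn' := qPoch_ne_zero hq hq (n + 1)
  rw [qPoch_succ] at hn' ⊢
  rw [← sub_div, ← mul_div_assoc, div_eq_div_iff hn' hn]
  ring

theorem tendsto_rogersRamanujan (hq : ‖q‖ < 1) :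
    Tendsto (rogersRamanujan q) (𝓝 0) (𝓝 1) := by
  obtain ⟨C, hC⟩ := exists_norm_inv_qPoch_le hq hq
  have hz : Tendsto (fun a : ℂ => a * q) (𝓝 0) (𝓝 0) := by
    simpa using (tendsto_id (x := 𝓝 (0 : ℂ))).mul_const q
  have h := tendsto_tsum_pow_choose_two_mul (c₀ := 1) (norm_pow_lt_one hq two_ne_zero) hz
    (.of_forall fun _ => hC) (by simp [qPoch_zero])
  exact h.congr fun a => tsum_congr fun n => by
    rw [← sq_mul_pow_eq_choose_two, div_eq_mul_inv]

/-- The alternating series of Selberg and Andrews. Its parameters are chosen so that `i + j` is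
preserved by the recurrence `selbergSeries_succ`; the two Rogers–Ramanujan identities correspond
to `i + j = 2`. -/
noncomputable def selbergSeries (i j : ℕ) (q a : ℂ) : ℂ :=
  ∑' n : ℕ, (q ^ (2 * (i + j) + 1)) ^ n.choose 2 * (-(a ^ (i + j) * q ^ (j + 1))) ^ n *
    ((1 - a ^ i * q ^ (2 * i * n)) * (qPoch a q n / qPoch q q n))

theorem exists_norm_qPoch_div_le (hq : ‖q‖ < 1) (R : ℝ) :
    ∃ M, ∀ a : ℂ, ‖a‖ ≤ R → ∀ n, ‖qPoch a q n / qPoch q q n‖ ≤ M := by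
  obtain ⟨D, hD⟩ := exists_norm_inv_qPoch_le hq hq
  refine ⟨Real.exp (R / (1 - ‖q‖)) * D, fun a ha n => ?_⟩
  rw [div_eq_mul_inv, norm_mul]
  have ha' : ‖qPoch a q n‖ ≤ Real.exp (R / (1 - ‖q‖)) :=
    (norm_qPoch_le a hq n).trans
      (Real.exp_le_exp.2 (div_le_div_of_nonneg_right ha (sub_nonneg.2 hq.le)))
  exact mul_le_mul ha' (hD n) (norm_nonneg _) (Real.exp_nonneg _)

theorem exists_norm_selbergSeries_coeff_le (i : ℕ) (hq : ‖q‖ < 1) (R : ℝ) :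
    ∃ M, ∀ a : ℂ, ‖a‖ ≤ R → ∀ n,
      ‖(1 - a ^ i * q ^ (2 * i * n)) * (qPoch a q n / qPoch q q n)‖ ≤ M := by
  obtain ⟨M, hM⟩ := exists_norm_qPoch_div_le hq R
  refine ⟨(1 + R ^ i) * M, fun a ha n => ?_⟩
  have hM' := hM a ha n
  have hR : 0 ≤ R := (norm_nonneg a).trans ha
  have hfactor : ‖1 - a ^ i * q ^ (2 * i * n)‖ ≤ 1 + R ^ i := by
    refine (norm_sub_le _ _).trans ?_
    rw [norm_one, norm_mul, norm_pow, norm_pow]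
    have hqn : ‖q‖ ^ (2 * i * n) ≤ 1 := pow_le_one₀ (norm_nonneg q) hq.le
    have hai : ‖a‖ ^ i ≤ R ^ i := by gcongr
    nlinarith [pow_nonneg hR i, pow_nonneg (norm_nonneg q) (2 * i * n)]
  rw [norm_mul]
  gcongr

theorem summable_selbergSeries (i j : ℕ) (hq : ‖q‖ < 1) (a : ℂ) :
    Summable fun n : ℕ => (q ^ (2 * (i + j) + 1)) ^ n.choose 2 *
      (-(a ^ (i + j) * q ^ (j + 1))) ^ n *
        ((1 - a ^ i * q ^ (2 * i * n)) * (qPoch a q n / qPoch q q n)) := by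
  obtain ⟨M, hM⟩ := exists_norm_selbergSeries_coeff_le i hq ‖a‖
  exact (summable_norm_pow_choose_two_mul (norm_pow_lt_one hq (Nat.succ_ne_zero _)) _
    (hM a le_rfl)).of_norm

theorem selbergSeries_zero_left (j : ℕ) (q a : ℂ) : selbergSeries 0 j q a = 0 := by
  simp [selbergSeries]

theorem tendsto_selbergSeries {i : ℕ} (hi : i ≠ 0) (j : ℕ) (hq : ‖q‖ < 1) :
    Tendsto (selbergSeries i j q) (𝓝 0) (𝓝 1) := by
  obtain ⟨M, hM⟩ := exists_norm_selbergSeries_coeff_le i hq 1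
  have hsmall : ∀ᶠ a : ℂ in 𝓝 0, ‖a‖ ≤ 1 :=
    continuous_norm.continuousAt.eventually (ge_mem_nhds (by simp))
  refine tendsto_tsum_pow_choose_two_mul (norm_pow_lt_one hq (Nat.succ_ne_zero _)) ?_
    (hsmall.mono hM) ?_
  · have hcont : Continuous fun a : ℂ => -(a ^ (i + j) * q ^ (j + 1)) := by fun_prop
    simpa [hi] using hcont.tendsto 0
  · have hcont : Continuous fun a : ℂ => 1 - a ^ i := by fun_prop
    simpa [hi, qPoch_zero] using hcont.tendsto 0

theorem qPoch_div_qPoch_mul_one_sub (a q : ℂ) (n : ℕ) :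
    qPoch a q n / qPoch q q n * (1 - a * q ^ n) = (1 - a) * (qPoch (a * q) q n / qPoch q q n) := by
  rw [div_mul_eq_mul_div, ← qPoch_succ, qPoch_succ', mul_div_assoc]

theorem qPoch_succ_div_qPoch_succ_mul_one_sub (hq : ‖q‖ < 1) (a : ℂ) (n : ℕ) :
    qPoch a q (n + 1) / qPoch q q (n + 1) * (1 - q ^ (n + 1)) =
      (1 - a) * (qPoch (a * q) q n / qPoch q q n) := by
  have hn := one_sub_pow_ne_zero hq n.succ_ne_zero
  rw [qPoch_succ', qPoch_succ q, ← pow_succ', div_mul_eq_mul_div, mul_div_mul_right _ _ hn,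
    mul_div_assoc]

theorem tsum_eq_tsum_add_of_shift {f g k : ℕ → ℂ} (hf : Summable f) (hg : Summable g)
    (hk : Summable k) (h0 : f 0 = g 0) (hsucc : ∀ n, f (n + 1) = g (n + 1) + k n) :
    ∑' n, f n = ∑' n, (g n + k n) := by
  rw [hf.tsum_eq_zero_add, h0, tsum_congr hsucc, ((summable_nat_add_iff 1).2 hg).tsum_add hk,
    hg.tsum_add hk, hg.tsum_eq_zero_add, add_assoc]

theorem selbergSeries_succ (i j : ℕ) (hq : ‖q‖ < 1) (a : ℂ) :
    selbergSeries (i + 1) j q a =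
      selbergSeries i (j + 1) q a + a ^ i * (1 - a) * selbergSeries (j + 1) i q (a * q) := by
  obtain ⟨M, hM⟩ := exists_norm_qPoch_div_le hq ‖a * q‖
  set Q := q ^ (2 * (i + 1 + j) + 1) with hQ
  have hQ1 : ‖Q‖ < 1 := norm_pow_lt_one hq (Nat.succ_ne_zero _)
  have hsum (z : ℂ) :
      Summable fun n => Q ^ n.choose 2 * z ^ n * (qPoch (a * q) q n / qPoch q q n) :=
    (summable_norm_pow_choose_two_mul hQ1 z (hM _ le_rfl)).of_norm
  have h₁ := summable_selbergSeries (i + 1) j hq a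
  have h₂ := summable_selbergSeries i (j + 1) hq a
  rw [← sub_eq_iff_eq_add', selbergSeries, selbergSeries, selbergSeries, ← h₁.tsum_sub h₂,
    ← tsum_mul_left]
  refine (tsum_eq_tsum_add_of_shift (h₁.sub h₂)
    ((hsum (-(a ^ (i + 1 + j) * q ^ (2 * i + j + 2)))).mul_left (a ^ i * (1 - a)))
    ((hsum (-(a ^ (i + 1 + j) * q ^ (j + 1) * Q))).mul_left
      (-(a ^ (i + 1 + j) * q ^ (j + 1)) * (1 - a))) ?_ fun n => ?_).trans
    (tsum_congr fun n => ?_)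
  · simp only [Nat.choose_zero_succ, pow_zero, mul_one, mul_zero, qPoch_zero, ne_eq, one_ne_zero,
      not_false_eq_true, div_self, one_mul, sub_sub_sub_cancel_left]
    ring
  · have hs := qPoch_succ_div_qPoch_succ_mul_one_sub hq a n
    have hm := qPoch_div_qPoch_mul_one_sub a q (n + 1)
    rw [choose_two_succ, show i + (j + 1) = i + 1 + j by ring, ← hQ]
    linear_combination (Q ^ (n + n.choose 2) * (-(a ^ (i + 1 + j) * q ^ (j + 1))) ^ (n + 1)) * hs +
      (a ^ i * Q ^ (n + n.choose 2) *
        (-(a ^ (i + 1 + j) * q ^ (2 * i + j + 2))) ^ (n + 1)) * hm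
  · rw [show j + 1 + i = i + 1 + j by ring, hQ]
    ring

theorem selbergSeries_one_one (hq : ‖q‖ < 1) (a : ℂ) :
    selbergSeries 1 1 q a = (1 - a) * selbergSeries 2 0 q (a * q) := by
  rw [selbergSeries_succ 0 1 hq, selbergSeries_zero_left, zero_add, pow_zero, one_mul]

theorem selbergSeries_two_zero (hq : ‖q‖ < 1) (a : ℂ) :
    selbergSeries 2 0 q a =
      (1 - a) * (selbergSeries 2 0 q (a * q) +
        a * (1 - a * q) * selbergSeries 2 0 q (a * q ^ 2)) := by
  rw [selbergSeries_succ 1 0 hq, selbergSeries_one_one hq, selbergSeries_one_one hq, pow_one]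
  ring_nf

theorem selbergSeries_two_zero_div_qPochInf (hq : ‖q‖ < 1) {a : ℂ} (ha : ‖a‖ < 1) :
    selbergSeries 2 0 q a / qPochInf a q = selbergSeries 2 0 q (a * q) / qPochInf (a * q) q +
      a * (selbergSeries 2 0 q (a * q ^ 2) / qPochInf (a * q ^ 2) q) := by
  have haq : ‖a * q‖ < 1 := by simpa using norm_mul_pow_lt_one ha hq 1
  have h₁ := one_sub_ne_zero_of_norm_lt_one ha
  have h₂ := one_sub_ne_zero_of_norm_lt_one haq
  have h₃ := qPochInf_ne_zero (norm_mul_pow_lt_one ha hq 2) hq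
  rw [selbergSeries_two_zero hq, qPochInf_eq_one_sub_mul a hq, qPochInf_eq_one_sub_mul (a * q) hq,
    mul_assoc a q q, ← sq]
  field_simp

theorem rogersRamanujan_mul_qPochInf (hq : ‖q‖ < 1) {a : ℂ} (ha : ‖a * q‖ < 1) :
    rogersRamanujan q a * qPochInf (a * q) q = selbergSeries 2 0 q (a * q) := by
  have hpow := tendsto_pow_atTop_nhds_zero_of_norm_lt_one hq
  have hR : Tendsto (fun k : ℕ => a * q ^ k) atTop (𝓝 0) := by simpa using hpow.const_mul a
  have hS : Tendsto (fun k : ℕ => a * q * q ^ k) atTop (𝓝 0) := by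
    simpa using hpow.const_mul (a * q)
  have hsum : Summable fun k : ℕ => ‖a * q * q ^ k‖ := by
    simpa only [norm_mul, norm_pow] using
      (summable_geometric_of_lt_one (norm_nonneg q) hq).mul_left (‖a‖ * ‖q‖)
  have h := eq_zero_of_recurrence (D := fun k => rogersRamanujan q (a * q ^ k) -
    selbergSeries 2 0 q (a * q * q ^ k) / qPochInf (a * q * q ^ k) q) hsum (fun k => ?_) ?_ 0
  · rw [pow_zero, mul_one, mul_one, sub_eq_zero] at h
    rw [h, div_mul_cancel₀ _ (qPochInf_ne_zero ha hq)]
  · have h₁ := rogersRamanujan_eq_add hq (a * q ^ k)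
    have h₂ := selbergSeries_two_zero_div_qPochInf hq (norm_mul_pow_lt_one ha hq k)
    simp only [smul_eq_mul, pow_add, pow_one, mul_assoc] at h₁ h₂ ⊢
    rw [h₁, h₂]
    ring_nf
  · simpa using ((tendsto_rogersRamanujan hq).comp hR).sub
      (((tendsto_selbergSeries two_ne_zero 0 hq).comp hS).div
        ((tendsto_qPochInf_nhds_zero hq).comp hS) one_ne_zero)

theorem rogersRamanujan_one_mul_qPochInf (hq : ‖q‖ < 1) :
    rogersRamanujan q 1 * qPochInf q q = selbergSeries 2 0 q q := by
  simpa only [one_mul] using rogersRamanujan_mul_qPochInf hq (a := 1) (by simpa using hq)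

theorem rogersRamanujan_self_mul_qPochInf (hq : ‖q‖ < 1) :
    rogersRamanujan q q * qPochInf q q = selbergSeries 1 1 q q := by
  have hqq : ‖q * q‖ < 1 := by simpa [← sq] using norm_pow_lt_one hq two_ne_zero
  rw [selbergSeries_one_one hq, ← rogersRamanujan_mul_qPochInf hq hqq,
    qPochInf_eq_one_sub_mul q hq]
  ring

end RogersRamanujan

section TripleProduct

variable {q x : ℂ}

/-- Divided by `(yq;q)_∞`, this is the Durfee square decomposition of partitions. -/
theorem tsum_durfee (hq : ‖q‖ < 1) (y : ℂ) :
    ∑' n : ℕ, q ^ n ^ 2 * y ^ n / qPoch q q n * qPochInf (y * q ^ (n + 1)) q = 1 := by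
  obtain ⟨x, rfl⟩ := IsAlgClosed.exists_pow_nat_eq q two_pos
  have hx : ‖x‖ < 1 := norm_lt_one_of_norm_pow_lt_one hq
  obtain ⟨M, hM⟩ := exists_norm_coeff_qExpBig_le hq
  have h := tsum_sq_mul_qPochInf hx (x * y) (-1) hM
  rw [qExpBig_mul_rescale_neg_one_qExpSmall (not_isOfFinOrder_of_norm_lt_one hq)] at h
  have h1 : ∑' N : ℕ, x ^ N ^ 2 * (x * y) ^ N * PowerSeries.coeff N (1 : PowerSeries ℂ) = 1 := by
    rw [tsum_eq_single 0 fun N hN => by rw [PowerSeries.coeff_one, if_neg hN, mul_zero]]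
    simp
  rw [← h1, ← h]
  refine tsum_congr fun n => ?_
  rw [coeff_qExpBig, show -(x ^ (2 * n + 1) * (x * y) * -1) = y * (x ^ 2) ^ (n + 1) by ring,
    ← pow_mul, ← pow_mul, ← two_mul_choose_two_add_self n, mul_pow]
  ring

theorem two_mul_mul_sub_one_ediv_two (n : ℤ) : 2 * (n * (n - 1) / 2) = n * (n - 1) :=
  Int.mul_ediv_cancel' (Int.even_mul_pred_self n).two_dvd

theorem natCast_mul_sub_one_ediv_two (n : ℕ) : (n : ℤ) * (n - 1) / 2 = n.choose 2 := by
  have h := two_mul_mul_sub_one_ediv_two n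
  have h' : (2 * n.choose 2 + n : ℤ) = n ^ 2 := mod_cast two_mul_choose_two_add_self n
  linarith

theorem qPochInf_eq_zero (hq : ‖q‖ < 1) {a : ℂ} {n : ℕ} (h : a * q ^ n = 1) :
    qPochInf a q = 0 := by
  rw [qPochInf_eq_qPoch_mul a hq (n + 1), qPoch_succ, h, sub_self, mul_zero, zero_mul]

theorem hasSum_euler (hq : ‖q‖ < 1) (z : ℂ) :
    HasSum (fun n : ℕ => q ^ n.choose 2 * z ^ n / qPoch q q n) (qPochInf (-z) q) := by
  rw [← tsum_euler hq]
  exact (summable_norm_euler hq z).of_norm.hasSum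

theorem hasSum_int_euler (hq0 : q ≠ 0) (hq : ‖q‖ < 1) (z : ℂ) :
    HasSum (fun k : ℤ => q ^ (k * (k - 1) / 2) * z ^ k * qPochInf (q ^ (k + 1)) q)
      (qPochInf (-z) q * qPochInf q q) := by
  refine (Nat.cast_injective.hasSum_iff fun k hk => ?_).1 ?_
  · obtain ⟨n, rfl⟩ : ∃ n : ℕ, k = -(n + 1) :=
      ⟨(-k - 1).toNat, by have := mt (fun h => ⟨k.toNat, Int.toNat_of_nonneg h⟩) hk; omega⟩
    rw [qPochInf_eq_zero hq (n := n), mul_zero]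
    rw [← zpow_natCast, ← zpow_add₀ hq0]
    simp
  · rw [← tsum_euler hq]
    refine ((summable_norm_euler hq z).of_norm.hasSum.mul_right _).congr_fun fun n => ?_
    rw [Function.comp_apply, natCast_mul_sub_one_ediv_two, zpow_natCast, zpow_natCast,
      ← Nat.cast_succ, zpow_natCast, Nat.succ_eq_add_one, pow_succ', qPochInf_eq_qPoch_mul q hq n]
    have := qPoch_ne_zero hq hq n
    field_simp

theorem jacobi_durfee_term (hq0 : q ≠ 0) {z : ℂ} (hz : z ≠ 0) (k : ℤ) (n : ℕ) :
    q ^ ((k + n) * (k + n - 1) / 2) * z ^ (k + n) * (q ^ n.choose 2 * (q / z) ^ n) =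
      q ^ (k * (k - 1) / 2) * z ^ k * (q ^ n ^ 2 * (q ^ k) ^ n) := by
  have hexp : (k + n) * (k + n - 1) / 2 + (n.choose 2 + n : ℕ) =
      k * (k - 1) / 2 + (n ^ 2 : ℕ) + k * n := by
    have h₁ := two_mul_mul_sub_one_ediv_two (k + n)
    have h₂ := two_mul_mul_sub_one_ediv_two k
    have h₃ : (2 * n.choose 2 + n : ℤ) = n ^ 2 := mod_cast two_mul_choose_two_add_self n
    push_cast
    linarith
  have hpow := congrArg (q ^ ·) hexp
  simp only [zpow_add₀ hq0, zpow_natCast, zpow_mul, pow_add] at hpow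
  rw [zpow_add₀ hz, zpow_natCast, div_pow]
  field_simp
  linear_combination hpow

/-- Collect the terms with the same `k - n` in the double series, over `k ∈ ℤ` and `n ∈ ℕ`, of the
product: what remains is a Durfee sum. -/
theorem hasSum_jacobi_triple_product (hq0 : q ≠ 0) (hq : ‖q‖ < 1) {z : ℂ} (hz : z ≠ 0) :
    HasSum (fun k : ℤ => q ^ (k * (k - 1) / 2) * z ^ k)
      (qPochInf (-z) q * qPochInf q q * qPochInf (-(q / z)) q) := by
  set f : ℤ → ℂ := fun k => q ^ (k * (k - 1) / 2) * z ^ k * qPochInf (q ^ (k + 1)) q with hf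
  set g : ℕ → ℂ := fun n => q ^ n.choose 2 * (q / z) ^ n / qPoch q q n with hg
  have hfsum : HasSum f (qPochInf (-z) q * qPochInf q q) := hasSum_int_euler hq0 hq z
  have hgsum : HasSum g (qPochInf (-(q / z)) q) := hasSum_euler hq (q / z)
  have hprod := hfsum.mul hgsum
    (summable_mul_of_summable_norm hfsum.summable.norm hgsum.summable.norm)
  let shear : ℤ × ℕ ≃ ℤ × ℕ :=
    ⟨fun p => (p.1 + p.2, p.2), fun p => (p.1 - p.2, p.2), fun p => by simp, fun p => by simp⟩
  have hshear : HasSum (fun p : ℤ × ℕ => q ^ (p.1 * (p.1 - 1) / 2) * z ^ p.1 *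
      (q ^ p.2 ^ 2 * (q ^ p.1) ^ p.2 / qPoch q q p.2 * qPochInf (q ^ p.1 * q ^ (p.2 + 1)) q))
      (qPochInf (-z) q * qPochInf q q * qPochInf (-(q / z)) q) := by
    refine (shear.hasSum_iff.2 hprod).congr_fun fun ⟨k, n⟩ => ?_
    have hpow : q ^ (k + n + 1) = q ^ k * q ^ (n + 1) := by
      rw [add_assoc, zpow_add₀ hq0]
      norm_cast
    simp only [Function.comp_apply, shear, Equiv.coe_fn_mk, hf, hg, hpow]
    linear_combination -(qPochInf (q ^ k * q ^ (n + 1)) q / qPoch q q n) *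
      jacobi_durfee_term hq0 hz k n
  refine hshear.prod_fiberwise fun k => (hshear.summable.prod_factor k).hasSum_iff.2 ?_
  simp only [tsum_mul_left, tsum_durfee hq, mul_one]

/-- The theta function `θ(x;p) = (x;p)_∞ (p/x;p)_∞`, so that `J_{a,m} = θ(q^a;q^m) J_m`. -/
noncomputable def qTheta (x p : ℂ) : ℂ := qPochInf x p * qPochInf (p / x) p

theorem tsum_eq_qTheta_mul (hq0 : q ≠ 0) (hq : ‖q‖ < 1) (hx : x ≠ 0) :
    ∑' n : ℕ, q ^ n.choose 2 * (-(q / x)) ^ n * (1 - x ^ (2 * n + 1)) =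
      qTheta x q * qPochInf q q := by
  have h := (hasSum_jacobi_triple_product hq0 hq
    (neg_ne_zero.2 (div_ne_zero hq0 hx))).nat_add_neg_add_one
  rw [div_neg, neg_neg, neg_neg, div_div_cancel₀ hq0] at h
  rw [qTheta, mul_comm (qPochInf x q), mul_right_comm, ← h.tsum_eq]
  refine tsum_congr fun n => ?_
  have hexp : -((n : ℤ) + 1) * (-(n + 1) - 1) / 2 = n.choose 2 + (2 * n + 1 : ℕ) := by
    rw [← natCast_mul_sub_one_ediv_two]
    have h₁ := two_mul_mul_sub_one_ediv_two (-((n : ℤ) + 1))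
    have h₂ := two_mul_mul_sub_one_ediv_two n
    push_cast
    linarith
  set w := -(q / x) with hw
  have hw0 : w ≠ 0 := neg_ne_zero.2 (div_ne_zero hq0 hx)
  have hqw : q ^ (2 * n + 1) = -(w * x) ^ (2 * n + 1) := by
    rw [hw, neg_mul, div_mul_cancel₀ q hx, Odd.neg_pow ⟨n, rfl⟩, neg_neg]
  have hwn : w ^ (-((n : ℤ) + 1)) * w ^ (2 * n + 1) = w ^ n := by
    rw [← zpow_natCast w (2 * n + 1), ← zpow_add₀ hw0, ← zpow_natCast w n]
    congr 1
    push_cast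
    ring
  rw [natCast_mul_sub_one_ediv_two, hexp, zpow_add₀ hq0, zpow_natCast, zpow_natCast, zpow_natCast,
    hqw, mul_pow]
  linear_combination q ^ n.choose 2 * x ^ (2 * n + 1) * hwn

theorem selbergSeries_self (i j : ℕ) (hq0 : q ≠ 0) (hq : ‖q‖ < 1) :
    selbergSeries i j q q =
      qTheta (q ^ i) (q ^ (2 * (i + j) + 1)) *
        qPochInf (q ^ (2 * (i + j) + 1)) (q ^ (2 * (i + j) + 1)) := by
  have hQ : ‖q ^ (2 * (i + j) + 1)‖ < 1 := norm_pow_lt_one hq (Nat.succ_ne_zero _)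
  rw [← tsum_eq_qTheta_mul (pow_ne_zero _ hq0) hQ (pow_ne_zero i hq0)]
  refine tsum_congr fun n => ?_
  have hquot : q ^ (2 * (i + j) + 1) / q ^ i = q ^ (i + j) * q ^ (j + 1) := by
    rw [div_eq_iff (pow_ne_zero i hq0)]
    ring
  have hodd : q ^ i * q ^ (2 * i * n) = (q ^ i) ^ (2 * n + 1) := by ring
  simp only [div_self (qPoch_ne_zero hq hq n), hquot, hodd, mul_one]

end TripleProduct

section Products

variable {q x p : ℂ}

theorem qTheta_div (hp : p ≠ 0) : qTheta (p / x) p = qTheta x p := by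
  rw [qTheta, qTheta, div_div_cancel₀ hp, mul_comm]

theorem qTheta_pow_of_add_eq (hq : q ≠ 0) {a b m : ℕ} (h : a + b = m) :
    qTheta (q ^ a) (q ^ m) = qPochInf (q ^ a) (q ^ m) * qPochInf (q ^ b) (q ^ m) := by
  rw [qTheta, ← h, pow_add, mul_div_cancel_left₀ _ (pow_ne_zero a hq)]

theorem qTheta_pow_comm (hq : q ≠ 0) {a b m : ℕ} (h : a + b = m) :
    qTheta (q ^ a) (q ^ m) = qTheta (q ^ b) (q ^ m) := by
  rw [qTheta_pow_of_add_eq hq h, qTheta_pow_of_add_eq hq ((add_comm b a).trans h), mul_comm]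

theorem qTheta_mul_qTheta_neg (x : ℂ) (hp : ‖p‖ < 1) :
    qTheta x p * qTheta (-x) p = qTheta (x ^ 2) (p ^ 2) := by
  rw [qTheta, qTheta, qTheta, ← qPochInf_mul_qPochInf_neg x hp, ← div_pow,
    ← qPochInf_mul_qPochInf_neg (p / x) hp, div_neg]
  ring

theorem qTheta_eq_mul_qTheta_sq (x : ℂ) (hp0 : p ≠ 0) (hp : ‖p‖ < 1) :
    qTheta x p = qTheta x (p ^ 2) * qTheta (x * p) (p ^ 2) := by
  rw [qTheta, qTheta, qTheta, qPochInf_eq_prod x hp two_ne_zero,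
    qPochInf_eq_prod (p / x) hp two_ne_zero, Finset.prod_range_succ, Finset.prod_range_one,
    Finset.prod_range_succ, Finset.prod_range_one, pow_zero, mul_one, mul_one, pow_one,
    sq, mul_div_mul_right _ _ hp0, div_mul_eq_mul_div]
  ring

theorem qPochInf_self_eq_qTheta (hq0 : q ≠ 0) (hq : ‖q‖ < 1) :
    qPochInf q q = qTheta q (q ^ 5) * qTheta (q ^ 2) (q ^ 5) * qPochInf (q ^ 5) (q ^ 5) := by
  have h1 := qTheta_pow_of_add_eq hq0 (show 1 + 4 = 5 from rfl)
  rw [pow_one] at h1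
  rw [qPochInf_eq_prod q hq (d := 5) (by norm_num), h1,
    qTheta_pow_of_add_eq hq0 (show 2 + 3 = 5 from rfl)]
  simp only [Finset.prod_range_succ, Finset.prod_range_zero, ← pow_succ', zero_add, pow_one,
    Nat.reduceAdd]
  ring

theorem qTheta_pow_ne_zero (hq0 : q ≠ 0) (hq : ‖q‖ < 1) {a b m : ℕ} (ha : a ≠ 0) (hb : b ≠ 0)
    (h : a + b = m) : qTheta (q ^ a) (q ^ m) ≠ 0 := by
  have hm : ‖q ^ m‖ < 1 := norm_pow_lt_one hq (by omega)
  rw [qTheta_pow_of_add_eq hq0 h]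
  exact mul_ne_zero (qPochInf_ne_zero (norm_pow_lt_one hq ha) hm)
    (qPochInf_ne_zero (norm_pow_lt_one hq hb) hm)

theorem rogersRamanujan_one_mul_qTheta (hq0 : q ≠ 0) (hq : ‖q‖ < 1) :
    rogersRamanujan q 1 * qTheta q (q ^ 5) = 1 := by
  have h := rogersRamanujan_one_mul_qPochInf hq
  have h5 := norm_pow_lt_one hq (n := 5) (by norm_num)
  rw [selbergSeries_self 2 0 hq0 hq, qPochInf_self_eq_qTheta hq0 hq] at h
  refine mul_right_cancel₀ (mul_ne_zero (qTheta_pow_ne_zero hq0 hq two_ne_zero three_ne_zero rfl)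
    (qPochInf_ne_zero h5 h5)) ?_
  linear_combination h

theorem rogersRamanujan_self_mul_qTheta (hq0 : q ≠ 0) (hq : ‖q‖ < 1) :
    rogersRamanujan q q * qTheta (q ^ 2) (q ^ 5) = 1 := by
  have h := rogersRamanujan_self_mul_qPochInf hq
  have h5 := norm_pow_lt_one hq (n := 5) (by norm_num)
  rw [selbergSeries_self 1 1 hq0 hq, qPochInf_self_eq_qTheta hq0 hq] at h
  refine mul_right_cancel₀ (mul_ne_zero (qTheta_pow_ne_zero hq0 hq one_ne_zero four_ne_zero rfl)
    (qPochInf_ne_zero h5 h5)) ?_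
  rw [pow_one] at h ⊢
  linear_combination h

theorem qJ_ne_zero (hq : ‖q‖ < 1) {m : ℕ} (hm : m ≠ 0) : qJ q m ≠ 0 :=
  qPochInf_ne_zero (norm_pow_lt_one hq hm) (norm_pow_lt_one hq hm)

theorem qJ₂_eq_qTheta_mul_qJ (hq0 : q ≠ 0) (a : ℤ) (m : ℕ) :
    qJ₂ q a m = qTheta (q ^ a) (q ^ m) * qJ q m := by
  rw [qJ₂, qTheta, qJ, zpow_sub₀ hq0, zpow_natCast]

theorem rogersRamanujan_pow_four_one_mul_qJ (hq0 : q ≠ 0) (hq : ‖q‖ < 1) :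
    rogersRamanujan (q ^ 4) 1 * qJ q 4 = qJ₂ q 8 20 := by
  rw [qJ, rogersRamanujan_one_mul_qPochInf (norm_pow_lt_one hq four_ne_zero),
    selbergSeries_self 2 0 (pow_ne_zero 4 hq0) (norm_pow_lt_one hq four_ne_zero),
    qJ₂_eq_qTheta_mul_qJ hq0, qJ, ← pow_mul, ← pow_mul]
  norm_cast

theorem rogersRamanujan_pow_four_self_mul_qJ (hq0 : q ≠ 0) (hq : ‖q‖ < 1) :
    rogersRamanujan (q ^ 4) (q ^ 4) * qJ q 4 = qJ₂ q 4 20 := by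
  rw [qJ, rogersRamanujan_self_mul_qPochInf (norm_pow_lt_one hq four_ne_zero),
    selbergSeries_self 1 1 (pow_ne_zero 4 hq0) (norm_pow_lt_one hq four_ne_zero),
    qJ₂_eq_qTheta_mul_qJ hq0, qJ, ← pow_mul, ← pow_mul]
  norm_cast

theorem qTheta_neg_base (hp0 : p ≠ 0) (hp : ‖p‖ < 1) (x : ℂ) :
    qTheta x (-p) = qTheta x (p ^ 2) * qTheta (-(x * p)) (p ^ 2) := by
  rw [qTheta_eq_mul_qTheta_sq x (neg_ne_zero.2 hp0) (by rwa [norm_neg]), neg_sq, mul_neg]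

theorem qJ_two_eq_qTheta (hq0 : q ≠ 0) (hq : ‖q‖ < 1) :
    qJ q 2 = qTheta (q ^ 2) (q ^ 10) * qTheta (q ^ 4) (q ^ 10) * qJ q 10 := by
  have h := qPochInf_self_eq_qTheta (pow_ne_zero 2 hq0) (norm_pow_lt_one hq two_ne_zero)
  simpa only [qJ, ← pow_mul] using h

theorem qTheta_pow_mul_qTheta_neg_pow (hq : ‖q‖ < 1) (a : ℕ) {m : ℕ} (hm : m ≠ 0) :
    qTheta (q ^ a) (q ^ m) * qTheta (-q ^ a) (q ^ m) = qTheta (q ^ (2 * a)) (q ^ (2 * m)) := by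
  rw [qTheta_mul_qTheta_neg _ (norm_pow_lt_one hq hm), ← pow_mul, ← pow_mul, mul_comm a, mul_comm m]

theorem qTheta_pow_eq_mul_qTheta_pow (hq0 : q ≠ 0) (hq : ‖q‖ < 1) (a : ℕ) {m : ℕ} (hm : m ≠ 0) :
    qTheta (q ^ a) (q ^ m) = qTheta (q ^ a) (q ^ (2 * m)) * qTheta (q ^ (a + m)) (q ^ (2 * m)) := by
  rw [qTheta_eq_mul_qTheta_sq _ (pow_ne_zero m hq0) (norm_pow_lt_one hq hm), ← pow_mul, ← pow_add,
    mul_comm m]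

theorem rogersRamanujan_neg_one_mul_qJ (hq0 : q ≠ 0) (hq : ‖q‖ < 1) :
    rogersRamanujan (-q) 1 * qJ q 2 * qJ q 20 = qJ₂ q 1 10 * qJ₂ q 8 20 := by
  have hR := rogersRamanujan_one_mul_qTheta (neg_ne_zero.2 hq0) (by rwa [norm_neg])
  have hneg : qTheta (-q) ((-q) ^ 5) = qTheta (-q) (q ^ 10) * qTheta (q ^ 4) (q ^ 10) := by
    rw [Odd.neg_pow (by decide), qTheta_neg_base (pow_ne_zero 5 hq0)
      (norm_pow_lt_one hq (by norm_num)), neg_mul, neg_neg, ← pow_succ', ← pow_mul,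
      qTheta_pow_comm hq0 (show 4 + 6 = 10 from rfl)]
  have hpair : qTheta q (q ^ 10) * qTheta (-q) (q ^ 10) = qTheta (q ^ 2) (q ^ 20) := by
    simpa only [pow_one] using qTheta_pow_mul_qTheta_neg_pow hq 1 (m := 10) (by norm_num)
  have hsplit : qTheta (q ^ 2) (q ^ 10) = qTheta (q ^ 2) (q ^ 20) * qTheta (q ^ 8) (q ^ 20) := by
    rw [qTheta_pow_comm hq0 (show 8 + 12 = 20 from rfl)]
    exact qTheta_pow_eq_mul_qTheta_pow hq0 hq 2 (by norm_num)
  have hJ₁ : qJ₂ q 1 10 = qTheta q (q ^ 10) * qJ q 10 := by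
    simpa only [zpow_one] using qJ₂_eq_qTheta_mul_qJ hq0 1 10
  have hJ₈ : qJ₂ q 8 20 = qTheta (q ^ 8) (q ^ 20) * qJ q 20 := qJ₂_eq_qTheta_mul_qJ hq0 8 20
  rw [hneg] at hR
  rw [qJ_two_eq_qTheta hq0 hq, hJ₁, hJ₈, hsplit, ← hpair]
  linear_combination
    (qTheta q (q ^ 10) * qTheta (q ^ 8) (q ^ 20) * qJ q 10 * qJ q 20) * hR

theorem rogersRamanujan_neg_self_mul_qJ (hq0 : q ≠ 0) (hq : ‖q‖ < 1) :
    rogersRamanujan (-q) (-q) * qJ q 2 * qJ q 20 = qJ₂ q 3 10 * qJ₂ q 4 20 := by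
  have hR := rogersRamanujan_self_mul_qTheta (neg_ne_zero.2 hq0) (by rwa [norm_neg])
  have hneg : qTheta ((-q) ^ 2) ((-q) ^ 5) =
      qTheta (q ^ 2) (q ^ 10) * qTheta (-q ^ 3) (q ^ 10) := by
    rw [neg_sq, Odd.neg_pow (by decide), qTheta_neg_base (pow_ne_zero 5 hq0)
      (norm_pow_lt_one hq (by norm_num)), ← pow_mul,
      ← qTheta_div (pow_ne_zero 10 hq0) (x := -q ^ 3)]
    congr 2
    field_simp
  have hpair : qTheta (q ^ 3) (q ^ 10) * qTheta (-q ^ 3) (q ^ 10) = qTheta (q ^ 6) (q ^ 20) :=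
    qTheta_pow_mul_qTheta_neg_pow hq 3 (by norm_num)
  have hsplit : qTheta (q ^ 4) (q ^ 10) = qTheta (q ^ 4) (q ^ 20) * qTheta (q ^ 6) (q ^ 20) := by
    rw [qTheta_pow_comm hq0 (show 6 + 14 = 20 from rfl)]
    exact qTheta_pow_eq_mul_qTheta_pow hq0 hq 4 (by norm_num)
  have hJ₃ : qJ₂ q 3 10 = qTheta (q ^ 3) (q ^ 10) * qJ q 10 := qJ₂_eq_qTheta_mul_qJ hq0 3 10
  have hJ₄ : qJ₂ q 4 20 = qTheta (q ^ 4) (q ^ 20) * qJ q 20 := qJ₂_eq_qTheta_mul_qJ hq0 4 20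
  rw [hneg] at hR
  rw [qJ_two_eq_qTheta hq0 hq, hJ₃, hJ₄, hsplit, ← hpair]
  linear_combination
    (qTheta (q ^ 3) (q ^ 10) * qTheta (q ^ 4) (q ^ 20) * qJ q 10 * qJ q 20) * hR

theorem qJ_pow (q : ℂ) (d m : ℕ) : qJ (q ^ d) m = qJ q (d * m) := by
  rw [qJ, qJ, pow_mul]

theorem qPochInf_self_sq_mul_qJ (hq : ‖q‖ < 1) : qPochInf q (q ^ 2) * qJ q 2 = qJ q 1 := by
  rw [qJ, qJ, pow_one, qPochInf_eq_prod q hq two_ne_zero, Finset.prod_range_succ,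
    Finset.prod_range_one, pow_zero, mul_one, pow_one, sq]

theorem qPochInf_neg_sq_mul_qJ (hq : ‖q‖ < 1) : qPochInf (-q ^ 2) (q ^ 2) * qJ q 2 = qJ q 4 := by
  rw [qJ, qJ, mul_comm, qPochInf_mul_qPochInf_neg _ (norm_pow_lt_one hq two_ne_zero), ← pow_mul]

theorem qPochInf_neg_self_mul_qJ (hq : ‖q‖ < 1) :
    qPochInf (-q) (q ^ 2) * (qJ q 1 * qJ q 4) = qJ q 2 ^ 2 := by
  have h₂ := qPochInf_self_sq_mul_qJ (norm_pow_lt_one hq two_ne_zero)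
  have hpair := qPochInf_mul_qPochInf_neg q (norm_pow_lt_one hq two_ne_zero)
  rw [qJ_pow, qJ_pow, ← hpair] at h₂
  linear_combination qJ q 2 * h₂ - qPochInf (-q) (q ^ 2) * qJ q 4 * qPochInf_self_sq_mul_qJ hq

end Products

section Nahm

variable {q r : ℂ}

theorem summable_norm_pow_mul_pow_sq_div_qPoch (hr : ‖r‖ < 1) (hq : ‖q‖ < 1) (x : ℂ) :
    Summable fun n : ℕ => ‖x ^ n * r ^ n ^ 2 / qPoch q q n‖ := by
  obtain ⟨C, hC⟩ := exists_norm_inv_qPoch_le hq hq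
  refine (summable_norm_pow_choose_two_mul (norm_pow_lt_one hr two_ne_zero) (r * x) hC).congr
    fun n => ?_
  rw [← two_mul_choose_two_add_self, pow_add, pow_mul, mul_pow, div_eq_mul_inv]
  ring_nf

theorem summable_nahmTerm (hr : ‖r‖ < 1) (u v w t : ℂ) :
    Summable (nahmTerm r u v w t) := by
  have hq : ‖(r ^ 4) ^ 2‖ < 1 :=
    norm_pow_lt_one (norm_pow_lt_one hr four_ne_zero) two_ne_zero
  set f : ℂ → ℕ → ℂ := fun x n => x ^ n * r ^ n ^ 2 / qPoch ((r ^ 4) ^ 2) ((r ^ 4) ^ 2) n with hf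
  have hsum (x : ℂ) : Summable fun n => ‖f x n‖ :=
    summable_norm_pow_mul_pow_sq_div_qPoch hr hq x
  refine .of_norm_bounded ((hsum u).mul_norm ((hsum v).mul_norm ((hsum w).mul_norm (hsum t)))) ?_
  rintro ⟨i, j, k, l⟩
  have hkl : (0 : ℤ) ≤ k * l := by positivity
  obtain ⟨e, he⟩ := Int.le.dest (show (i ^ 2 + j ^ 2 + k ^ 2 + l ^ 2 : ℕ) ≤
      4 * (i : ℤ) ^ 2 + 4 * (j : ℤ) ^ 2 + 4 * (k : ℤ) ^ 2 + 5 * (l : ℤ) ^ 2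
        - 4 * (i : ℤ) * l - 4 * (j : ℤ) * l + 4 * (k : ℤ) * l by
    push_cast
    nlinarith [sq_nonneg (3 * (i : ℤ) - 2 * l), sq_nonneg (3 * (j : ℤ) - 2 * l),
      sq_nonneg (k : ℤ), sq_nonneg (l : ℤ)])
  have hterm : nahmTerm r u v w t (i, j, k, l) = f u i * (f v j * (f w k * f t l)) * r ^ e := by
    rw [nahmTerm, ← he, ← Nat.cast_add, zpow_natCast, hf]
    ring
  rw [hterm, norm_mul _ (r ^ e)]
  exact mul_le_of_le_one_right (norm_nonneg _) (by simpa using pow_le_one₀ (norm_nonneg r) hr.le)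

theorem nahmF_comm (r u v w t : ℂ) : nahmF r u v w t = nahmF r v u w t := by
  let swap : ℕ × ℕ × ℕ × ℕ ≃ ℕ × ℕ × ℕ × ℕ :=
    ⟨fun p => (p.2.1, p.1, p.2.2), fun p => (p.2.1, p.1, p.2.2), fun _ => rfl, fun _ => rfl⟩
  rw [nahmF, ← swap.tsum_eq]
  refine tsum_congr fun ⟨i, j, k, l⟩ => ?_
  simp only [nahmTerm, swap, Equiv.coe_fn_mk]
  ring_nf

/-- The sum of the terms of `F(u,v,w,t;q²)` with a fixed last index `l`, evaluated by Euler's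
identity; here `q = r ^ 4`. -/
noncomputable def nahmSlice (q r u v w t : ℂ) (l : ℕ) : ℂ :=
  t ^ l * r ^ (5 * l ^ 2) / qPoch (q ^ 2) (q ^ 2) l *
    (qPochInf (-(u * q / q ^ l)) (q ^ 2) *
      (qPochInf (-(v * q / q ^ l)) (q ^ 2) * qPochInf (-(w * q * q ^ l)) (q ^ 2)))

theorem nahmTerm_eq_mul_euler (hr0 : r ≠ 0) (hr : r ^ 4 = q) (u v w t : ℂ) (i j k l : ℕ) :
    nahmTerm r u v w t (i, j, k, l) = t ^ l * r ^ (5 * l ^ 2) / qPoch (q ^ 2) (q ^ 2) l *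
      ((q ^ 2) ^ i.choose 2 * (u * q / q ^ l) ^ i / qPoch (q ^ 2) (q ^ 2) i *
        ((q ^ 2) ^ j.choose 2 * (v * q / q ^ l) ^ j / qPoch (q ^ 2) (q ^ 2) j *
          ((q ^ 2) ^ k.choose 2 * (w * q * q ^ l) ^ k / qPoch (q ^ 2) (q ^ 2) k))) := by
  have hexp : 4 * (i : ℤ) ^ 2 + 4 * (j : ℤ) ^ 2 + 4 * (k : ℤ) ^ 2 + 5 * (l : ℤ) ^ 2
      - 4 * (i : ℤ) * l - 4 * (j : ℤ) * l + 4 * (k : ℤ) * l =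
      (4 * i ^ 2 + 4 * j ^ 2 + (4 * k ^ 2 + 5 * l ^ 2 + 4 * k * l) : ℕ) -
        (4 * i * l + 4 * j * l : ℕ) := by
    push_cast
    ring
  have hsq (n : ℕ) : q ^ n ^ 2 = (q ^ 2) ^ n.choose 2 * q ^ n := by
    rw [← two_mul_choose_two_add_self, pow_add, pow_mul]
  have hpow : r ^ (4 * (i : ℤ) ^ 2 + 4 * (j : ℤ) ^ 2 + 4 * (k : ℤ) ^ 2 + 5 * (l : ℤ) ^ 2
      - 4 * (i : ℤ) * l - 4 * (j : ℤ) * l + 4 * (k : ℤ) * l) =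
      q ^ i ^ 2 * q ^ j ^ 2 * q ^ k ^ 2 * r ^ (5 * l ^ 2) * (q ^ l) ^ k /
        ((q ^ l) ^ i * (q ^ l) ^ j) := by
    rw [hexp, zpow_sub₀ hr0, zpow_natCast, zpow_natCast, ← hr]
    ring
  rw [nahmTerm, hpow, hsq, hsq, hsq, hr]
  ring

theorem hasSum_mul_mul_of_summable_norm {f g h : ℕ → ℂ} {a b c : ℂ} (hf : HasSum f a)
    (hg : HasSum g b) (hh : HasSum h c) (hf' : Summable fun n => ‖f n‖)
    (hg' : Summable fun n => ‖g n‖) (hh' : Summable fun n => ‖h n‖) :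
    HasSum (fun p : ℕ × ℕ × ℕ => f p.1 * (g p.2.1 * h p.2.2)) (a * (b * c)) := by
  have hgh : HasSum (fun p : ℕ × ℕ => g p.1 * h p.2) (b * c) :=
    hg.mul hh (summable_mul_of_summable_norm hg' hh')
  have hgh' : Summable fun p : ℕ × ℕ => ‖g p.1 * h p.2‖ := hg'.mul_norm hh'
  exact HasSum.mul (g := fun p : ℕ × ℕ => g p.1 * h p.2) hf hgh
    (summable_mul_of_summable_norm (g := fun p : ℕ × ℕ => g p.1 * h p.2) hf' hgh')

theorem hasSum_nahmSlice (hr0 : r ≠ 0) (hr : r ^ 4 = q) (hq : ‖q‖ < 1) (u v w t : ℂ) :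
    HasSum (nahmSlice q r u v w t) (nahmF r u v w t) := by
  have hq2 := norm_pow_lt_one hq two_ne_zero
  let lastFirst : ℕ × ℕ × ℕ × ℕ ≃ ℕ × ℕ × ℕ × ℕ :=
    ⟨fun p => (p.2.1, p.2.2.1, p.2.2.2, p.1), fun p => (p.2.2.2, p.1, p.2.1, p.2.2.1),
      fun _ => rfl, fun _ => rfl⟩
  have hsum : Summable (nahmTerm r u v w t) :=
    summable_nahmTerm (norm_lt_one_of_norm_pow_lt_one (hr ▸ hq)) u v w t
  have hslice (l : ℕ) :
      HasSum (fun p => nahmTerm r u v w t (lastFirst (l, p))) (nahmSlice q r u v w t l) := by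
    refine ((hasSum_mul_mul_of_summable_norm (hasSum_euler hq2 _) (hasSum_euler hq2 _)
      (hasSum_euler hq2 _) (summable_norm_euler hq2 _) (summable_norm_euler hq2 _)
      (summable_norm_euler hq2 _)).mul_left _).congr_fun fun p => ?_
    exact nahmTerm_eq_mul_euler hr0 hr u v w t p.1 p.2.1 p.2.2 l
  have hreindex : HasSum (nahmTerm r u v w t ∘ lastFirst) (nahmF r u v w t) :=
    lastFirst.hasSum_iff.2 hsum.hasSum
  exact hreindex.prod_fiberwise hslice

theorem nahmF_eq_tsum_even_add_tsum_odd (hr0 : r ≠ 0) (hr : r ^ 4 = q) (hq : ‖q‖ < 1)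
    (u v w t : ℂ) :
    nahmF r u v w t =
      ∑' m, nahmSlice q r u v w t (2 * m) + ∑' m, nahmSlice q r u v w t (2 * m + 1) := by
  have h := hasSum_nahmSlice hr0 hr hq u v w t
  rw [← h.tsum_eq]
  refine (tsum_even_add_odd (h.summable.comp_injective (mul_right_injective₀ two_ne_zero))
    (h.summable.comp_injective fun m n hmn => ?_)).symm
  simpa using hmn

end Nahm

section Evaluations

variable {q r : ℂ}

theorem qPochInf_mul_pow {a p : ℂ} (ha : ‖a‖ < 1) (hp : ‖p‖ < 1) (n : ℕ) :
    qPochInf (a * p ^ n) p = qPochInf a p / qPoch a p n := by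
  rw [qPochInf_eq_qPoch_mul a hp n, mul_div_cancel_left₀ _ (qPoch_ne_zero ha hp n)]

theorem sq_pow_choose_two_succ (q : ℂ) (m : ℕ) : (q ^ 2) ^ (m + 1).choose 2 = q ^ (m ^ 2 + m) := by
  rw [← pow_mul, choose_two_succ, mul_add, ← two_mul_choose_two_add_self]
  congr 1
  ring

theorem qPochInf_neg_div_pow_two_mul (hq0 : q ≠ 0) (hq : ‖q‖ < 1) (m : ℕ) :
    qPochInf (-(q / q ^ (2 * m))) (q ^ 2) =
      qPoch (-q) (q ^ 2) m / q ^ m ^ 2 * qPochInf (-q) (q ^ 2) := by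
  rw [pow_mul, ← neg_div, qPochInf_div_pow (neg_ne_zero.2 hq0) (pow_ne_zero 2 hq0)
    (norm_pow_lt_one hq two_ne_zero), neg_neg, sq_pow_choose_two_succ, pow_add,
    show q ^ 2 / -q = -q by field_simp]
  field_simp

theorem qPochInf_neg_one_div_pow_two_mul (hq0 : q ≠ 0) (hq : ‖q‖ < 1) (m : ℕ) :
    qPochInf (-(1 / q ^ (2 * m))) (q ^ 2) =
      2 * qPoch (-q ^ 2) (q ^ 2) m / q ^ (m ^ 2 + m) * qPochInf (-q ^ 2) (q ^ 2) := by
  have hq2 := norm_pow_lt_one hq two_ne_zero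
  rw [pow_mul, ← neg_div, qPochInf_div_pow (neg_ne_zero.2 one_ne_zero) (pow_ne_zero 2 hq0) hq2,
    neg_neg, one_pow, sq_pow_choose_two_succ, div_neg, div_one, qPochInf_eq_one_sub_mul (-1) hq2,
    neg_one_mul]
  ring

theorem qPochInf_neg_mul_pow_two_mul (hq : ‖q‖ < 1) (m : ℕ) :
    qPochInf (-(q * q ^ (2 * m))) (q ^ 2) = qPochInf (-q) (q ^ 2) / qPoch (-q) (q ^ 2) m := by
  rw [pow_mul, ← neg_mul]
  exact qPochInf_mul_pow (by rwa [norm_neg]) (norm_pow_lt_one hq two_ne_zero) m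

theorem qPochInf_neg_sq_mul_pow_two_mul (hq : ‖q‖ < 1) (m : ℕ) :
    qPochInf (-(q ^ 2 * q ^ (2 * m))) (q ^ 2) =
      qPochInf (-q ^ 2) (q ^ 2) / qPoch (-q ^ 2) (q ^ 2) m := by
  have hq2 := norm_pow_lt_one hq two_ne_zero
  rw [pow_mul, ← neg_mul]
  exact qPochInf_mul_pow (by rwa [norm_neg]) hq2 m

theorem qPoch_two_mul (a p : ℂ) (m : ℕ) :
    qPoch a p (2 * m) = qPoch a (p ^ 2) m * qPoch (a * p) (p ^ 2) m := by
  simp [qPoch_mul, Finset.prod_range_succ]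

theorem qPoch_sq_two_mul (q : ℂ) (m : ℕ) :
    qPoch (q ^ 2) (q ^ 2) (2 * m) =
      qPoch q (q ^ 2) m * qPoch (-q) (q ^ 2) m * qPoch (q ^ 4) (q ^ 4) m := by
  rw [qPoch_two_mul, qPoch_mul_qPoch_neg, ← pow_add, ← pow_mul]

theorem qPoch_sq_two_mul_add_one (q : ℂ) (m : ℕ) :
    qPoch (q ^ 2) (q ^ 2) (2 * m + 1) =
      qPoch q (q ^ 2) (m + 1) * qPoch (-q) (q ^ 2) (m + 1) * qPoch (q ^ 4) (q ^ 4) m := by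
  rw [qPoch_succ, qPoch_sq_two_mul, qPoch_succ q, qPoch_succ (-q)]
  ring

theorem qPoch_self_two_mul (p : ℂ) (m : ℕ) :
    qPoch p p (2 * m) = qPoch p (p ^ 2) m * qPoch p p m * qPoch (-p) p m := by
  rw [qPoch_two_mul, mul_assoc, qPoch_mul_qPoch_neg, ← sq]

theorem qPoch_self_two_mul_add_one (p : ℂ) (m : ℕ) :
    qPoch p p (2 * m + 1) = qPoch p (p ^ 2) (m + 1) * qPoch p p m * qPoch (-p) p m := by
  rw [qPoch_succ, qPoch_self_two_mul, qPoch_succ p (p ^ 2)]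
  ring

theorem qPochInf_neg_div_mul_qPochInf_neg {p x : ℂ} (hp : ‖p‖ < 1) (hx : x ≠ 0) :
    qPochInf (-(p / x)) p * qPochInf (-x) p =
      x * (qPochInf (-(1 / x)) p * qPochInf (-(p * x)) p) := by
  rw [qPochInf_eq_one_sub_mul (-x) hp, qPochInf_eq_one_sub_mul (-(1 / x)) hp,
    show -(1 / x) * p = -(p / x) by ring, show -x * p = -(p * x) by ring]
  field_simp
  ring

theorem pow_five_mul_sq_two_mul (hr : r ^ 4 = q) (m : ℕ) :
    r ^ (5 * (2 * m) ^ 2) = q ^ (5 * m ^ 2) := by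
  rw [← hr]
  ring

theorem pow_five_mul_sq_two_mul_add_one (hr : r ^ 4 = q) (m : ℕ) :
    r ^ (5 * (2 * m + 1) ^ 2) = r ^ 5 * q ^ (5 * m ^ 2 + 5 * m) := by
  rw [← hr]
  ring

theorem qPoch_neg_self_ne_zero (hq : ‖q‖ < 1) (m : ℕ) : qPoch (-q) (q ^ 2) m ≠ 0 :=
  qPoch_ne_zero (by rwa [norm_neg]) (norm_pow_lt_one hq two_ne_zero) m

theorem qPoch_neg_sq_ne_zero (hq : ‖q‖ < 1) (m : ℕ) : qPoch (-q ^ 2) (q ^ 2) m ≠ 0 :=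
  qPoch_ne_zero (by rw [norm_neg]; exact norm_pow_lt_one hq two_ne_zero)
    (norm_pow_lt_one hq two_ne_zero) m

theorem nahmSlice_one_two_mul (hr : r ^ 4 = q) (hq0 : q ≠ 0) (hq : ‖q‖ < 1) (t : ℂ) (m : ℕ) :
    nahmSlice q r 1 1 1 t (2 * m) = qPochInf (-q) (q ^ 2) ^ 3 *
      (t ^ (2 * m) * q ^ (3 * m ^ 2) / (qPoch q (q ^ 2) m * qPoch (q ^ 4) (q ^ 4) m)) := by
  have hm := qPoch_neg_self_ne_zero hq m
  rw [nahmSlice, one_mul, qPochInf_neg_div_pow_two_mul hq0 hq, qPochInf_neg_mul_pow_two_mul hq,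
    pow_five_mul_sq_two_mul hr, qPoch_sq_two_mul,
    show q ^ (5 * m ^ 2) = q ^ (3 * m ^ 2) * (q ^ m ^ 2) ^ 2 by ring]
  field_simp

theorem nahmSlice_one_two_mul_add_one (hr : r ^ 4 = q) (hq0 : q ≠ 0) (hq : ‖q‖ < 1) (t : ℂ)
    (m : ℕ) :
    nahmSlice q r 1 1 1 t (2 * m + 1) = 4 * r ^ 5 * (qPochInf (-q ^ 2) (q ^ 2) ^ 3 *
      (t ^ (2 * m + 1) * q ^ (3 * m ^ 2 + 3 * m) /
        (qPoch (q ^ 2) ((q ^ 2) ^ 2) (m + 1) * qPoch (q ^ 2) (q ^ 2) m))) := by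
  have hm := qPoch_neg_sq_ne_zero hq m
  have hdiv : q / q ^ (2 * m + 1) = 1 / q ^ (2 * m) := by field_simp; ring
  rw [nahmSlice, one_mul, hdiv, show q * q ^ (2 * m + 1) = q ^ 2 * q ^ (2 * m) by ring,
    qPochInf_neg_one_div_pow_two_mul hq0 hq, qPochInf_neg_sq_mul_pow_two_mul hq,
    pow_five_mul_sq_two_mul_add_one hr, qPoch_self_two_mul_add_one,
    show q ^ (5 * m ^ 2 + 5 * m) = q ^ (3 * m ^ 2 + 3 * m) * (q ^ (m ^ 2 + m)) ^ 2 by ring]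
  field_simp
  ring

theorem nahmSlice_inv_two_mul (hr : r ^ 4 = q) (hq0 : q ≠ 0) (hq : ‖q‖ < 1) (m : ℕ) :
    nahmSlice q r q⁻¹ q q⁻¹ (r ^ 2)⁻¹ (2 * m) = 4 * (qPochInf (-q ^ 2) (q ^ 2) ^ 3 *
      ((q ^ 2) ^ (m ^ 2 + m.choose 2) /
        (qPoch (q ^ 2) ((q ^ 2) ^ 2) m * qPoch (q ^ 2) (q ^ 2) m))) := by
  have hm := qPoch_neg_sq_ne_zero hq m
  have htheta := qPochInf_neg_div_mul_qPochInf_neg (norm_pow_lt_one hq two_ne_zero)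
    (pow_ne_zero (2 * m) hq0)
  have hweight : (r ^ 2)⁻¹ ^ (2 * m) * q ^ (5 * m ^ 2) =
      (q ^ 2) ^ (m ^ 2 + m.choose 2) * (q ^ (m ^ 2 + m)) ^ 2 / q ^ (2 * m) := by
    have ht : (r ^ 2)⁻¹ ^ (2 * m) = (q ^ m)⁻¹ := by rw [← hr]; ring
    rw [ht, inv_mul_eq_div, div_eq_div_iff (pow_ne_zero _ hq0) (pow_ne_zero _ hq0),
      ← two_mul_choose_two_add_self]
    ring
  rw [nahmSlice, inv_mul_cancel₀ hq0, one_mul, ← sq, htheta,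
    qPochInf_neg_one_div_pow_two_mul hq0 hq, qPochInf_neg_sq_mul_pow_two_mul hq,
    pow_five_mul_sq_two_mul hr, qPoch_self_two_mul, hweight]
  field_simp
  ring

theorem nahmSlice_inv_two_mul_add_one (hr : r ^ 4 = q) (hq0 : q ≠ 0) (hq : ‖q‖ < 1) (m : ℕ) :
    nahmSlice q r q⁻¹ q q⁻¹ (r ^ 2)⁻¹ (2 * m + 1) = r⁻¹ * (qPochInf (-q) (q ^ 2) ^ 3 *
      (q ^ (3 * m ^ 2 + 2 * m) / (qPoch q (q ^ 2) (m + 1) * qPoch (q ^ 4) (q ^ 4) m))) := by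
  have hm := qPoch_neg_self_ne_zero hq m
  have hm' := qPoch_neg_self_ne_zero hq (m + 1)
  have hr0 : r ≠ 0 := ne_zero_pow four_ne_zero (hr ▸ hq0)
  have hu : 1 / q ^ (2 * m + 1) = q / q ^ (2 * (m + 1)) := by field_simp; ring
  have hv : q * q / q ^ (2 * m + 1) = q / q ^ (2 * m) := by field_simp; ring
  have hweight : (r ^ 2)⁻¹ ^ (2 * m + 1) * (r ^ 5 * q ^ (5 * m ^ 2 + 5 * m)) =
      r⁻¹ * (q ^ (3 * m ^ 2 + 2 * m) * (q ^ m ^ 2 * q ^ (m + 1) ^ 2)) := by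
    rw [inv_pow, ← pow_mul, ← hr]
    field_simp
    ring
  rw [nahmSlice, inv_mul_cancel₀ hq0, one_mul, hu, hv, pow_succ' q (2 * m),
    qPochInf_neg_div_pow_two_mul hq0 hq, qPochInf_neg_div_pow_two_mul hq0 hq,
    qPochInf_neg_mul_pow_two_mul hq, pow_five_mul_sq_two_mul_add_one hr, qPoch_sq_two_mul_add_one,
    hweight]
  field_simp

theorem qPochInf_neg_self_pow_three_mul (hq : ‖q‖ < 1) (S : ℂ) :
    qPochInf (-q) (q ^ 2) ^ 3 * S =
      qJ q 2 ^ 7 * (S * qPochInf q (q ^ 2) * qPochInf (-q ^ 2) (q ^ 2) * qJ q 2 * qJ q 20) /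
        (qJ q 1 ^ 4 * qJ q 4 ^ 4 * qJ q 20) := by
  have hJ (m : ℕ) (hm : m ≠ 0) : qJ q m ≠ 0 := qJ_ne_zero hq hm
  rw [eq_div_iff (by simp [hJ])]
  calc _ = (qPochInf (-q) (q ^ 2) * (qJ q 1 * qJ q 4)) ^ 3 * (qJ q 1 * qJ q 4 * S * qJ q 20) := by
        ring
    _ = (qJ q 2 ^ 2) ^ 3 * (qPochInf q (q ^ 2) * qJ q 2 * (qPochInf (-q ^ 2) (q ^ 2) * qJ q 2) *
          S * qJ q 20) := by
        rw [qPochInf_neg_self_mul_qJ hq, qPochInf_self_sq_mul_qJ hq, qPochInf_neg_sq_mul_qJ hq]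
    _ = _ := by ring

theorem qPochInf_neg_sq_pow_three_mul (hq : ‖q‖ < 1) (S : ℂ) :
    qPochInf (-q ^ 2) (q ^ 2) ^ 3 * S =
      qJ q 4 ^ 3 * (S * qPochInf (q ^ 2) ((q ^ 2) ^ 2) * qJ q 4) / qJ q 2 ^ 4 := by
  have h₂ := qPochInf_self_sq_mul_qJ (norm_pow_lt_one hq two_ne_zero)
  rw [qJ_pow, qJ_pow] at h₂
  rw [eq_div_iff (pow_ne_zero 4 (qJ_ne_zero hq two_ne_zero)), mul_assoc S, h₂,
    ← qPochInf_neg_sq_mul_qJ hq]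
  ring

theorem nahmF_inv_self_inv (hr : r ^ 4 = q) (hq0 : q ≠ 0) (hq : ‖q‖ < 1) :
    nahmF r q⁻¹ q q⁻¹ (r ^ 2)⁻¹ =
      4 * (qJ q 4 ^ 3 * qJ₂ q 8 20 / qJ q 2 ^ 4)
        + r⁻¹ * (qJ q 2 ^ 7 * qJ₂ q 3 10 * qJ₂ q 4 20 / (qJ q 1 ^ 4 * qJ q 4 ^ 4 * qJ q 20)) := by
  simp only [nahmF_eq_tsum_even_add_tsum_odd (ne_zero_pow four_ne_zero (hr ▸ hq0)) hr hq,
    nahmSlice_inv_two_mul hr hq0 hq, nahmSlice_inv_two_mul_add_one hr hq0 hq, tsum_mul_left]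
  rw [qPochInf_neg_self_pow_three_mul hq, qPochInf_neg_sq_pow_three_mul hq,
    tsum_slater_46 (norm_pow_lt_one hq two_ne_zero), ← pow_mul,
    rogersRamanujan_pow_four_one_mul_qJ hq0 hq, tsum_slater_15_shift hq,
    rogersRamanujan_neg_self_mul_qJ hq0 hq, mul_assoc (qJ q 2 ^ 7)]

theorem nahmF_one_one_one_inv (hr : r ^ 4 = q) (hq0 : q ≠ 0) (hq : ‖q‖ < 1) :
    nahmF r 1 1 1 q⁻¹ =
      qJ q 2 ^ 7 * qJ₂ q 3 10 * qJ₂ q 4 20 / (qJ q 1 ^ 4 * qJ q 4 ^ 4 * qJ q 20)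
        + 4 * r * (qJ q 4 ^ 3 * qJ₂ q 8 20 / qJ q 2 ^ 4) := by
  have heven (m : ℕ) : q⁻¹ ^ (2 * m) * q ^ (3 * m ^ 2) = q ^ (m ^ 2 + 4 * m.choose 2) := by
    rw [inv_pow, inv_mul_eq_iff_eq_mul₀ (pow_ne_zero _ hq0), ← two_mul_choose_two_add_self]
    ring
  have hodd (m : ℕ) : q⁻¹ ^ (2 * m + 1) * q ^ (3 * m ^ 2 + 3 * m) =
      q⁻¹ * (q ^ 2) ^ (m ^ 2 + m.choose 2 + m) := by
    rw [pow_succ', mul_assoc, inv_pow]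
    congr 1
    rw [inv_mul_eq_iff_eq_mul₀ (pow_ne_zero _ hq0),
      ← two_mul_choose_two_add_self]
    ring
  have hr5 : r ^ 5 * q⁻¹ = r := by rw [pow_succ', hr, mul_inv_cancel_right₀ hq0]
  simp only [nahmF_eq_tsum_even_add_tsum_odd (ne_zero_pow four_ne_zero (hr ▸ hq0)) hr hq,
    nahmSlice_one_two_mul hr hq0 hq, nahmSlice_one_two_mul_add_one hr hq0 hq, heven, hodd,
    mul_div_assoc q⁻¹, tsum_mul_left, mul_left_comm _ q⁻¹]
  rw [qPochInf_neg_self_pow_three_mul hq, qPochInf_neg_sq_pow_three_mul hq,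
    tsum_slater_46_shift (norm_pow_lt_one hq two_ne_zero), ← pow_mul,
    rogersRamanujan_pow_four_one_mul_qJ hq0 hq, tsum_slater_15 hq,
    rogersRamanujan_neg_self_mul_qJ hq0 hq, mul_assoc (qJ q 2 ^ 7)]
  linear_combination 4 * (qJ q 4 ^ 3 * qJ₂ q 8 20 / qJ q 2 ^ 4) * hr5

theorem nahmF_one_one_one_one (hr : r ^ 4 = q) (hq0 : q ≠ 0) (hq : ‖q‖ < 1) :
    nahmF r 1 1 1 1 =
      qJ q 2 ^ 7 * qJ₂ q 1 10 * qJ₂ q 8 20 / (qJ q 1 ^ 4 * qJ q 4 ^ 4 * qJ q 20)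
        + 4 * r ^ 5 * (qJ q 4 ^ 3 * qJ₂ q 4 20 / qJ q 2 ^ 4) := by
  have hodd (m : ℕ) : q ^ (3 * m ^ 2 + 3 * m) = (q ^ 2) ^ (m ^ 2 + m.choose 2 + 2 * m) := by
    rw [← two_mul_choose_two_add_self]
    ring
  simp only [nahmF_eq_tsum_even_add_tsum_odd (ne_zero_pow four_ne_zero (hr ▸ hq0)) hr hq,
    nahmSlice_one_two_mul hr hq0 hq, nahmSlice_one_two_mul_add_one hr hq0 hq, hodd, one_pow,
    one_mul, tsum_mul_left]
  rw [qPochInf_neg_self_pow_three_mul hq, qPochInf_neg_sq_pow_three_mul hq,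
    tsum_slater_44 (norm_pow_lt_one hq two_ne_zero), ← pow_mul,
    rogersRamanujan_pow_four_self_mul_qJ hq0 hq, tsum_slater_19 hq,
    rogersRamanujan_neg_one_mul_qJ hq0 hq, mul_assoc (qJ q 2 ^ 7)]

end Evaluations

theorem mainTheorem4 (q r : ℂ) (hr : r ^ 4 = q) (hq0 : q ≠ 0) (hq1 : ‖q‖ < 1) :
    (∀ u v w t : ℂ, Summable (nahmTerm r u v w t)) ∧
    (∀ u v w t : ℂ, nahmF r u v w t = nahmF r v u w t) ∧
    nahmF r q⁻¹ q q⁻¹ (r ^ 2)⁻¹ =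
      4 * (qJ q 4 ^ 3 * qJ₂ q 8 20 / qJ q 2 ^ 4)
        + r⁻¹ * (qJ q 2 ^ 7 * qJ₂ q 3 10 * qJ₂ q 4 20 / (qJ q 1 ^ 4 * qJ q 4 ^ 4 * qJ q 20)) ∧
    nahmF r 1 1 1 q⁻¹ =
      qJ q 2 ^ 7 * qJ₂ q 3 10 * qJ₂ q 4 20 / (qJ q 1 ^ 4 * qJ q 4 ^ 4 * qJ q 20)
        + 4 * r * (qJ q 4 ^ 3 * qJ₂ q 8 20 / qJ q 2 ^ 4) ∧
    nahmF r 1 1 1 1 =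
      qJ q 2 ^ 7 * qJ₂ q 1 10 * qJ₂ q 8 20 / (qJ q 1 ^ 4 * qJ q 4 ^ 4 * qJ q 20)
        + 4 * r ^ 5 * (qJ q 4 ^ 3 * qJ₂ q 4 20 / qJ q 2 ^ 4) := by
  have hr1 : ‖r‖ < 1 := norm_lt_one_of_norm_pow_lt_one (hr ▸ hq1)
  exact ⟨summable_nahmTerm hr1, nahmF_comm r,
    nahmF_inv_self_inv hr hq0 hq1, nahmF_one_one_one_inv hr hq0 hq1,
    nahmF_one_one_one_one hr hq0 hq1⟩
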